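/- In the problem $1\,||\,\Sigma w_jU_j$ we are given $n$ jobs $J_1,\dots,J_n$; job $J_j$ has a processing time $p_j$, a due date $d_j$ and a weight $w_j$, which are arbitrary non-negative integers. A schedule is a bijection $\pi:\{J_1,\dots,J_n\}\to\{1,\dots,n\}$; job $J_j$ is tardy in $\pi$ if its completion time $\sum_{i:\pi(J_i)\le\pi(J_j)}p_i$ is greater than $d_j$. The task is to compute a schedule that minimizes the total weight of the tardy jobs. Let $\nu_w$ and $\nu_p$ denote the number of different weights and the number of different processing times of the instance, respectively. Theorem. The problem $1\,||\,\Sigma w_jU_j$ is solvable in polynomial time when $\nu_w$ is constant, and when $\nu_p$ is constant. More precisely: (1) There is an algorithm that computes an optimal schedule for every instance and performs $O(n^{\nu_w+1}\log n)$ operations (additions, subtractions, comparisons and memory accesses on a random access machine with integer cells); for every constant $k$, its running time in bit operations (logarithmic cost) on the instances with $\nu_w\le k$ is bounded by a polynomial in the length of the binary encoding of the instance. (2) There is an algorithm that computes an optimal schedule for every instance and performs $O(n^{\nu_p+1}\log n)$ such operations; for every constant $k$, its running time in bit operations (logarithmic cost) on the instances with $\nu_p\le k$ is bounded by a polynomial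 in the length of the binary encoding of the instance. Here the constants implied by $O(\cdot)$ are absolute, and for $n\le 1$, where the logarithm vanishes, the bounds are to be read as $O(1)$. -/

import Mathlib

namespace TardyJobs

/-! ### The scheduling problem -/

/-- An instance with `n` jobs `0, …, n - 1`: job `j` has processing time `p j`, due date `d j` and
weight `w j`, all of them non-negative integers of arbitrary size. -/
structure Instance (n : ℕ) where
  p : Fin n → ℕ
  d : Fin n → ℕ
  w : Fin n → ℕ

namespace Instance

variable {n : ℕ} (I : Instance n)

/-- Completion time of job `j` when job `i` is processed at position `π i`, without idle time. -/
def completionTime (π : Equiv.Perm (Fin n)) (j : Fin n) : ℕ :=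
  ∑ i with π i ≤ π j, I.p i

/-- Total weight of the tardy jobs, that is, of the jobs completed after their due date. -/
def tardyWeight (π : Equiv.Perm (Fin n)) : ℕ :=
  ∑ j with I.d j < I.completionTime π j, I.w j

/-- The schedule `π` minimizes the weighted number of tardy jobs. -/
def IsOptimal (π : Equiv.Perm (Fin n)) : Prop :=
  ∀ σ : Equiv.Perm (Fin n), I.tardyWeight π ≤ I.tardyWeight σ

/-- The number of different weights. -/
def numWeights : ℕ := (Finset.univ.image I.w).card

/-- The number of different processing times. -/
def numProcTimes : ℕ := (Finset.univ.image I.p).card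

end Instance

/-! ### Random access machines

A program works on finitely many registers (the ones that it mentions) and on an unbounded memory.
Registers and memory cells hold natural numbers of arbitrary size. The only arithmetic is addition
and (truncated) subtraction; there is indirect addressing, and branching is on comparisons. -/

/-- Expressions; `load a` is the contents of the memory cell whose address is the value of `a`. -/
inductive Expr where
  | const (c : ℕ)
  | reg (r : ℕ)
  | load (a : Expr)
  | add (a b : Expr)
  | sub (a b : Expr)

/-- Programs. -/
inductive Prog where
  /-- do nothing -/
  | skip
  /-- register `r` receives the value of `e` -/
  | set (r : ℕ) (e : Expr)
  /-- the memory cell with address `a` receives the value of `e` -/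
  | store (a e : Expr)
  /-- first `P`, then `Q` -/
  | seq (P Q : Prog)
  /-- if `a < b` then `P` else `Q` -/
  | cond (a b : Expr) (P Q : Prog)
  /-- while `a < b` do `P` -/
  | loop (a b : Expr) (P : Prog)

structure State where
  reg : ℕ → ℕ
  mem : ℕ → ℕ

def Expr.eval (s : State) : Expr → ℕ
  | .const c => c
  | .reg r => s.reg r
  | .load a => s.mem (a.eval s)
  | .add a b => a.eval s + b.eval s
  | .sub a b => a.eval s - b.eval s

/-- Cost of evaluating an expression, when each operation is charged `ℓ v`, where `v` is the value
that it yields. An address is itself the value of an expression, hence it is charged as well. -/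
def Expr.cost (ℓ : ℕ → ℕ) (s : State) : Expr → ℕ
  | .const c => ℓ c
  | .reg r => ℓ (s.reg r)
  | .load a => a.cost ℓ s + ℓ (s.mem (a.eval s))
  | .add a b => a.cost ℓ s + b.cost ℓ s + ℓ (a.eval s + b.eval s)
  | .sub a b => a.cost ℓ s + b.cost ℓ s + ℓ (a.eval s - b.eval s)

/-- `Runs ℓ P s t s'`: the program `P`, started in state `s`, halts in state `s'` after time `t`,
where operations are charged according to `ℓ`. -/
inductive Runs (ℓ : ℕ → ℕ) : Prog → State → ℕ → State → Prop where
  | skip (s : State) : Runs ℓ .skip s 1 s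
  | set (r : ℕ) (e : Expr) (s : State) :
      Runs ℓ (.set r e) s (e.cost ℓ s + 1) ⟨Function.update s.reg r (e.eval s), s.mem⟩
  | store (a e : Expr) (s : State) :
      Runs ℓ (.store a e) s (a.cost ℓ s + e.cost ℓ s + 1)
        ⟨s.reg, Function.update s.mem (a.eval s) (e.eval s)⟩
  | seq {P Q : Prog} {s s₁ s₂ : State} {t₁ t₂ : ℕ} :
      Runs ℓ P s t₁ s₁ → Runs ℓ Q s₁ t₂ s₂ → Runs ℓ (.seq P Q) s (t₁ + t₂) s₂
  | cond_true {a b : Expr} {P Q : Prog} {s s' : State} {t : ℕ} :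
      a.eval s < b.eval s → Runs ℓ P s t s' →
      Runs ℓ (.cond a b P Q) s (a.cost ℓ s + b.cost ℓ s + 1 + t) s'
  | cond_false {a b : Expr} {P Q : Prog} {s s' : State} {t : ℕ} :
      ¬ a.eval s < b.eval s → Runs ℓ Q s t s' →
      Runs ℓ (.cond a b P Q) s (a.cost ℓ s + b.cost ℓ s + 1 + t) s'
  | loop_done {a b : Expr} {P : Prog} {s : State} :
      ¬ a.eval s < b.eval s → Runs ℓ (.loop a b P) s (a.cost ℓ s + b.cost ℓ s + 1) s
  | loop_step {a b : Expr} {P : Prog} {s s₁ s₂ : State} {t₁ t₂ : ℕ} :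
      a.eval s < b.eval s → Runs ℓ P s t₁ s₁ → Runs ℓ (.loop a b P) s₁ t₂ s₂ →
      Runs ℓ (.loop a b P) s (a.cost ℓ s + b.cost ℓ s + 1 + t₁ + t₂) s₂

/-- Uniform cost: every operation takes one unit of time. -/
def unitCost : ℕ → ℕ := fun _ => 1

/-- Logarithmic cost: the time of an operation is, up to an added 1, the number of binary digits of
the value that it yields. Polynomial time in this measure is polynomial time on Turing machines. -/
def bitCost : ℕ → ℕ := fun v => Nat.size v + 1

/-! ### Solving the problem on a machine -/

namespace Instance

variable {n : ℕ} (I : Instance n)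

/-- The input: cell `0` holds `n`, and the cells `3 j + 1`, `3 j + 2`, `3 j + 3` hold `p j`, `d j`,
`w j`. All other cells and all registers are `0`. -/
def initialState : State where
  reg := fun _ => 0
  mem := fun a =>
    if a = 0 then n
    else if h : (a - 1) / 3 < n then
      if (a - 1) % 3 = 0 then I.p ⟨(a - 1) / 3, h⟩
      else if (a - 1) % 3 = 1 then I.d ⟨(a - 1) / 3, h⟩
      else I.w ⟨(a - 1) / 3, h⟩
    else 0

/-- The length of the input in binary. -/
def inputLength : ℕ :=
  bitCost n + ∑ j, (bitCost (I.p j) + bitCost (I.d j) + bitCost (I.w j))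

end Instance

/-- The final state holds the schedule `π`: for every position `i`, cell `i` holds the index of the
job that is processed at position `i`. -/
def State.Holds {n : ℕ} (s : State) (π : Equiv.Perm (Fin n)) : Prop :=
  ∀ i : Fin n, s.mem i = (π.symm i : ℕ)

/-- On every instance, `P` halts and outputs an optimal schedule. -/
def Prog.Solves (P : Prog) : Prop :=
  ∀ (n : ℕ) (I : Instance n), ∃ (t : ℕ) (s : State) (π : Equiv.Perm (Fin n)),
    Runs unitCost P I.initialState t s ∧ s.Holds π ∧ I.IsOptimal π

/-- On the instance `I`, the program `P` halts within time `b`. -/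
def Prog.HaltsWithin (ℓ : ℕ → ℕ) (P : Prog) {n : ℕ} (I : Instance n) (b : ℕ) : Prop :=
  ∃ (t : ℕ) (s : State), Runs ℓ P I.initialState t s ∧ t ≤ b

/-- `P` runs in `O(n ^ (ν + 1) * log n)` operations, with an absolute implied constant, where `ν` is
a parameter of the instance. For `n ≥ 2` the summand `1` is immaterial; for `n ≤ 1`, where the
logarithm vanishes, it makes the bound a constant. -/
def Prog.RunsInTime (P : Prog) (ν : ∀ {n : ℕ}, Instance n → ℕ) : Prop :=
  ∃ C : ℕ, ∀ (n : ℕ) (I : Instance n),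
    P.HaltsWithin unitCost I (C * (n ^ (ν I + 1) * Nat.log 2 n + 1))

/-- For each constant `k`, the bit complexity of `P` on the instances with `ν ≤ k` is bounded by a
polynomial in the length of the input. -/
def Prog.PolyTimeForConstant (P : Prog) (ν : ∀ {n : ℕ}, Instance n → ℕ) : Prop :=
  ∀ k : ℕ, ∃ q : Polynomial ℕ, ∀ (n : ℕ) (I : Instance n),
    ν I ≤ k → P.HaltsWithin bitCost I (q.eval I.inputLength)

end TardyJobs

/-!
A set of jobs can be completed in time if and only if each of its jobs meets its due date when the
jobs of the set are processed first, by non-decreasing due dates; so the task is to find a set of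
maximal weight among these feasible sets. To solve the problem for few different weights, give each
job the key `(n + 1) ^ c`, where `c` is the number of its weight in a list of the different weights.
The base `n + 1` digits of the sum of the keys over a set of jobs count the jobs of each weight in
the set, so this sum determines the weight of the set, and it is less than `(n + 1) ^ ν`. A dynamic
program over the jobs in the order of their due dates keeps, for each sum of keys, a feasible set
of maximal weight minus processing time; as the weight is determined by the sum, this is a feasible
set of minimal processing time, which is all that matters for adding further jobs. With keys
according to the processing times, the same program keeps a feasible set of maximal weight among
the sets with a given processing time, and it solves the problem for few processing times.

The table has `n + 1` rows of `(n + 1) ^ ν` entries, each of which takes a bounded number of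
operations, and `(n + 1) ^ (ν + 1) ≤ 8 * n ^ (ν + 1)` because `ν ≤ n`. Since an operation at most
doubles the largest number in the machine, all numbers in a run of `t` operations have
`O(inputLength + t)` binary digits, which bounds the bit complexity.
-/

namespace TardyJobs

open Finset

local infixr:60 " ;; " => Prog.seq

/-! ### Uniform cost up to constant factors -/

/-- The number of nodes of an expression, which is its uniform cost. -/
def Expr.size : Expr → ℕ
  | .const _ => 1
  | .reg _ => 1
  | .load a => a.size + 1
  | .add a b => a.size + b.size + 1
  | .sub a b => a.size + b.size + 1

theorem Expr.cost_unitCost (s : State) (e : Expr) : e.cost unitCost s = e.size := by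
  induction e <;> simp_all [Expr.cost, Expr.size, unitCost]

/-- The size of a program: up to a constant factor, the uniform cost of executing each of its
instructions once. -/
def Prog.size : Prog → ℕ
  | .skip => 1
  | .set _ e => e.size + 1
  | .store a e => a.size + e.size + 1
  | .seq P Q => P.size + Q.size
  | .cond a b P Q => a.size + b.size + 1 + P.size + Q.size
  | .loop a b P => a.size + b.size + 1 + P.size

/-- Whether `P` contains an assignment to register `r`. -/
def Prog.assigns (r : ℕ) : Prog → Bool
  | .skip => false
  | .set r' _ => r' == r
  | .store _ _ => false
  | .seq P Q => P.assigns r || Q.assigns r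
  | .cond _ _ P Q => P.assigns r || Q.assigns r
  | .loop _ _ P => P.assigns r

/-- Whether `P` contains an instruction that writes to the memory. -/
def Prog.stores : Prog → Bool
  | .skip => false
  | .set _ _ => false
  | .store _ _ => true
  | .seq P Q => P.stores || Q.stores
  | .cond _ _ P Q => P.stores || Q.stores
  | .loop _ _ P => P.stores

/-- The states `s` and `s'` agree on everything that `P` has no instruction to change. -/
structure Prog.Frame (P : Prog) (s s' : State) : Prop where
  reg_eq : ∀ {r}, P.assigns r = false → s'.reg r = s.reg r
  mem_eq : P.stores = false → s'.mem = s.mem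

theorem Prog.Frame.refl (P : Prog) (s : State) : P.Frame s s := ⟨fun _ => rfl, fun _ => rfl⟩

theorem Prog.Frame.trans {P : Prog} {s₁ s₂ s₃ : State} (h : P.Frame s₁ s₂) (h' : P.Frame s₂ s₃) :
    P.Frame s₁ s₃ :=
  ⟨fun hr => (h'.reg_eq hr).trans (h.reg_eq hr), fun hm => (h'.mem_eq hm).trans (h.mem_eq hm)⟩

theorem Prog.Frame.weaken {P Q : Prog} {s s' : State} (h : P.Frame s s')
    (hr : ∀ r, Q.assigns r = false → P.assigns r = false)
    (hm : Q.stores = false → P.stores = false) : Q.Frame s s' :=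
  ⟨fun h' => h.reg_eq (hr _ h'), fun h' => h.mem_eq (hm h')⟩

theorem Runs.frame {ℓ : ℕ → ℕ} {P : Prog} {s s' : State} {t : ℕ} (h : Runs ℓ P s t s') :
    P.Frame s s' := by
  induction h with
  | skip | loop_done => exact .refl _ _
  | set r e s =>
    refine ⟨fun hr => Function.update_of_ne ?_ _ _, fun _ => rfl⟩
    rintro rfl
    simp [Prog.assigns] at hr
  | store => exact ⟨fun _ => rfl, fun h => by simp [Prog.stores] at h⟩
  | seq _ _ ih₁ ih₂ =>
    exact (ih₁.weaken (by simp_all [Prog.assigns]) (by simp_all [Prog.stores])).trans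
      (ih₂.weaken (by simp_all [Prog.assigns]) (by simp_all [Prog.stores]))
  | cond_true _ _ ih | cond_false _ _ ih =>
    exact ih.weaken (by simp_all [Prog.assigns]) (by simp_all [Prog.stores])
  | loop_step _ _ _ ih₁ ih₂ => exact .trans (ih₁.weaken (fun _ => id) id) ih₂

/-- From `s`, the program `P` reaches a state with property `Q` in at most `P.size * c` operations.
Counting time in units of the program's size makes the bound `c` compositional: it is the same for
all parts of a program that lie in the same loop. -/
def Ensures (P : Prog) (c : ℕ) (Q : State → Prop) (s : State) : Prop :=
  ∃ t s', Runs unitCost P s t s' ∧ t ≤ P.size * c ∧ Q s'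

namespace Ensures

variable {P Q : Prog} {c c' : ℕ} {R R' : State → Prop} {s : State}

theorem mono (h : Ensures P c R s) (hc : c ≤ c') (hR : ∀ s', P.Frame s s' → R s' → R' s') :
    Ensures P c' R' s := by
  obtain ⟨t, s', hr, ht, hs⟩ := h
  exact ⟨t, s', hr, ht.trans (Nat.mul_le_mul_left _ hc), hR _ hr.frame hs⟩

theorem seq (h : Ensures P c (Ensures Q c R) s) : Ensures (P ;; Q) c R s := by
  obtain ⟨t, s', hr, ht, t', s'', hr', ht', hR⟩ := h
  refine ⟨_, _, .seq hr hr', ?_, hR⟩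
  rw [Prog.size, Nat.add_mul]
  exact Nat.add_le_add ht ht'

theorem cond {a b : Expr} (hc : 1 ≤ c) (h₁ : a.eval s < b.eval s → Ensures P c R s)
    (h₂ : ¬ a.eval s < b.eval s → Ensures Q c R s) : Ensures (.cond a b P Q) c R s := by
  by_cases h : a.eval s < b.eval s
  · obtain ⟨t, s', hr, ht, hR⟩ := h₁ h
    refine ⟨_, _, .cond_true h hr, ?_, hR⟩
    simp only [Prog.size, Expr.cost_unitCost]
    nlinarith [Nat.zero_le (Q.size * c)]
  · obtain ⟨t, s', hr, ht, hR⟩ := h₂ h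
    refine ⟨_, _, .cond_false h hr, ?_, hR⟩
    simp only [Prog.size, Expr.cost_unitCost]
    nlinarith [Nat.zero_le (P.size * c)]

theorem loop {a b : Expr} {N : ℕ} (Inv : ℕ → State → Prop) (hc : 1 ≤ c) (h₀ : Inv 0 s)
    (hstep : ∀ k < N, ∀ s', Inv k s' → a.eval s' < b.eval s' ∧ Ensures P c (Inv (k + 1)) s')
    (hdone : ∀ s', Inv N s' → ¬ a.eval s' < b.eval s') :
    Ensures (.loop a b P) (c * (N + 1)) (Inv N) s := by
  suffices H : ∀ m k s, k + m = N → Inv k s →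
      Ensures (.loop a b P) (c * (m + 1)) (Inv N) s from H N 0 s (Nat.zero_add N) h₀
  intro m
  induction m with
  | zero =>
    rintro k s rfl hs
    refine ⟨_, s, .loop_done (hdone s hs), ?_, hs⟩
    simp only [Prog.size, Expr.cost_unitCost]
    nlinarith [Nat.zero_le (P.size * c)]
  | succ m ih =>
    intro k s hk hs
    obtain ⟨hlt, t, s', hr, ht, hs'⟩ := hstep k (by omega) s hs
    obtain ⟨t', s'', hr', ht', hs''⟩ := ih (k + 1) s' (by omega) hs'
    refine ⟨_, s'', .loop_step hlt hr hr', ?_, hs''⟩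
    simp only [Prog.size, Expr.cost_unitCost] at ht' ⊢
    nlinarith

end Ensures

/-- The effect of a program without loops. -/
def Prog.exec : Prog → State → State
  | .skip, s => s
  | .set r e, s => ⟨Function.update s.reg r (e.eval s), s.mem⟩
  | .store a e, s => ⟨s.reg, Function.update s.mem (a.eval s) (e.eval s)⟩
  | .seq P Q, s => Q.exec (P.exec s)
  | .cond a b P Q, s => if a.eval s < b.eval s then P.exec s else Q.exec s
  | .loop _ _ _, s => s

/-- Whether `P` contains no loop. -/
def Prog.loopFree : Prog → Bool
  | .seq P Q => P.loopFree && Q.loopFree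
  | .cond _ _ P Q => P.loopFree && Q.loopFree
  | .loop _ _ _ => false
  | _ => true

theorem Ensures.exec {P : Prog} (hP : P.loopFree = true) {c : ℕ} (hc : 1 ≤ c)
    {R : State → Prop} {s : State} (h : R (P.exec s)) : Ensures P c R s := by
  induction P generalizing s R with
  | skip => exact ⟨1, s, .skip s, by simpa [Prog.size] using hc, h⟩
  | set r e => exact ⟨_, _, .set r e s, by
      rw [Expr.cost_unitCost]; exact Nat.le_mul_of_pos_right _ hc, h⟩
  | store a e => exact ⟨_, _, .store a e s, by
      rw [Expr.cost_unitCost, Expr.cost_unitCost]; exact Nat.le_mul_of_pos_right _ hc, h⟩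
  | seq P₁ P₂ ih₁ ih₂ =>
    rw [Prog.loopFree, Bool.and_eq_true] at hP
    exact .seq (ih₁ hP.1 (ih₂ hP.2 h))
  | cond a b P₁ P₂ ih₁ ih₂ =>
    rw [Prog.loopFree, Bool.and_eq_true] at hP
    rw [Prog.exec] at h
    refine .cond hc (fun hab => ih₁ hP.1 ?_) (fun hab => ih₂ hP.2 ?_)
    · rwa [if_pos hab] at h
    · rwa [if_neg hab] at h
  | loop => simp [Prog.loopFree] at hP

/-- Increase register `r` by one. -/
def inc (r : ℕ) : Prog := .set r (.add (.reg r) (.const 1))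

/-- For `i` from `0` to the contents of register `b`, exclusively, do `P`. -/
def forTo (i b : ℕ) (P : Prog) : Prog := .set i (.const 0) ;; .loop (.reg i) (.reg b) (P ;; inc i)

theorem ensures_forTo {i b : ℕ} {P : Prog} {c N : ℕ} {s : State} (Inv : ℕ → State → Prop)
    (hc : 1 ≤ c) (hi : P.assigns i = false) (hb : P.assigns b = false) (hib : i ≠ b)
    (hN : s.reg b = N) (h₀ : Inv 0 ⟨Function.update s.reg i 0, s.mem⟩)
    (hstep : ∀ k < N, ∀ s', (forTo i b P).Frame s s' → s'.reg i = k → Inv k s' →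
      Ensures P c (fun s'' => Inv (k + 1) ⟨Function.update s''.reg i (k + 1), s''.mem⟩) s') :
    Ensures (forTo i b P) (c * (N + 1)) (Inv N) s := by
  have hframe {s₁ s₂ : State} (h : P.Frame s₁ s₂) : (forTo i b P).Frame s₁ s₂ :=
    h.weaken (by simp_all [forTo, Prog.assigns]) (by simp_all [forTo, Prog.stores])
  have hupdate (s' : State) (v : ℕ) :
      (forTo i b P).Frame s' ⟨Function.update s'.reg i v, s'.mem⟩ := by
    refine ⟨fun hr => Function.update_of_ne ?_ _ _, fun _ => rfl⟩
    rintro rfl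
    simp [forTo, Prog.assigns] at hr
  refine .seq (.exec rfl (hc.trans (Nat.le_mul_of_pos_right _ (Nat.succ_pos _))) (.mono (.loop
    (fun k s' => s'.reg b = N ∧ s'.reg i = k ∧ (forTo i b P).Frame s s' ∧ Inv k s') hc
    ?_ ?_ ?_) le_rfl fun s' _ h => h.2.2.2))
  · exact ⟨(Function.update_of_ne hib.symm _ _).trans hN, Function.update_self .., hupdate _ _, h₀⟩
  · rintro k hk s' ⟨hsb, hsi, hs, hInv⟩
    refine ⟨by simpa only [Expr.eval, hsb, hsi] using hk,
      .seq ((hstep k hk s' hs hsi hInv).mono le_rfl fun s'' hf hInv' => .exec rfl hc ?_)⟩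
    have hi'' : s''.reg i = k := (hf.reg_eq hi).trans hsi
    simp only [inc, Prog.exec, Expr.eval, hi'']
    exact ⟨(Function.update_of_ne hib.symm _ _).trans ((hf.reg_eq hb).trans hsb),
      Function.update_self .., (hs.trans (hframe hf)).trans (hupdate _ _), hInv'⟩
  · rintro s' ⟨hsb, hsi, -⟩
    simp only [Expr.eval, hsb, hsi, lt_irrefl, not_false_eq_true]

/-! ### Logarithmic cost -/

/-- The largest constant in an expression. -/
def Expr.maxConst : Expr → ℕ
  | .const c => c
  | .reg _ => 0
  | .load a => a.maxConst
  | .add a b => max a.maxConst b.maxConst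
  | .sub a b => max a.maxConst b.maxConst

/-- The largest constant in a program. -/
def Prog.maxConst : Prog → ℕ
  | .skip => 0
  | .set _ e => e.maxConst
  | .store a e => max a.maxConst e.maxConst
  | .seq P Q => max P.maxConst Q.maxConst
  | .cond a b P Q => max (max a.maxConst b.maxConst) (max P.maxConst Q.maxConst)
  | .loop a b P => max (max a.maxConst b.maxConst) P.maxConst

/-- All registers and memory cells hold numbers that are at most `B`. -/
def State.BddBy (s : State) (B : ℕ) : Prop := (∀ r, s.reg r ≤ B) ∧ ∀ a, s.mem a ≤ B

theorem two_pow_mono {a b : ℕ} (h : a ≤ b) : 2 ^ a ≤ 2 ^ b := Nat.pow_le_pow_right two_pos h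

theorem State.BddBy.mono {s : State} {B B' : ℕ} (hs : s.BddBy B) (h : B ≤ B') : s.BddBy B' :=
  ⟨fun r => (hs.1 r).trans h, fun a => (hs.2 a).trans h⟩

theorem update_le {f : ℕ → ℕ} {B a v : ℕ} (hf : ∀ x, f x ≤ B) (hv : v ≤ B) (x : ℕ) :
    Function.update f a v x ≤ B := by
  rw [Function.update_apply]
  split_ifs
  exacts [hv, hf x]

theorem Expr.eval_le {b : ℕ} {s : State} (hs : s.BddBy (2 ^ b)) {e : Expr}
    (he : e.maxConst ≤ 2 ^ b) : e.eval s ≤ 2 ^ (b + e.size) := by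
  induction e with
  | const c => exact he.trans (two_pow_mono (Nat.le_add_right _ _))
  | reg r => exact (hs.1 r).trans (two_pow_mono (Nat.le_add_right _ _))
  | load a => exact (hs.2 _).trans (two_pow_mono (Nat.le_add_right _ _))
  | add x y ihx ihy =>
    obtain ⟨hx, hy⟩ := max_le_iff.1 he
    calc x.eval s + y.eval s ≤ 2 ^ (b + x.size + y.size) + 2 ^ (b + x.size + y.size) :=
          Nat.add_le_add ((ihx hx).trans (two_pow_mono (by omega)))
            ((ihy hy).trans (two_pow_mono (by omega)))
      _ = 2 ^ (b + (x.size + y.size + 1)) := by ring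
  | sub x y ihx =>
    refine (Nat.sub_le _ _).trans ((ihx (max_le_iff.1 he).1).trans (two_pow_mono ?_))
    rw [Expr.size]
    omega

theorem bitCost_le {v b : ℕ} (h : v ≤ 2 ^ b) : bitCost v ≤ b + 2 :=
  Nat.succ_le_succ (Nat.size_le.2 (h.trans_lt (Nat.pow_lt_pow_right one_lt_two b.lt_succ_self)))

theorem Expr.cost_bitCost_le {b B : ℕ} {s : State} (hs : s.BddBy (2 ^ b)) {e : Expr}
    (he : e.maxConst ≤ 2 ^ b) (hB : b + e.size ≤ B) : e.cost bitCost s ≤ e.size * (B + 2) := by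
  have hv {e : Expr} (he : e.maxConst ≤ 2 ^ b) (hB : b + e.size ≤ B) :
      bitCost (e.eval s) ≤ B + 2 := bitCost_le ((Expr.eval_le hs he).trans (two_pow_mono hB))
  induction e with
  | const | reg => exact (hv he hB).trans_eq (Nat.one_mul _).symm
  | load a iha =>
    have ha := iha he ((Nat.add_le_add_left (Nat.le_succ _) b).trans hB)
    rw [Expr.size, Nat.add_mul, Nat.one_mul]
    exact Nat.add_le_add ha (hv (e := .load a) he hB)
  | add x y ihx ihy | sub x y ihx ihy =>
    obtain ⟨hx, hy⟩ := max_le_iff.1 he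
    have hxy := hv he hB
    rw [Expr.size] at hB
    rw [Expr.size, Nat.add_mul, Nat.add_mul, Nat.one_mul]
    exact Nat.add_le_add (Nat.add_le_add (ihx hx (by omega)) (ihy hy (by omega))) hxy

theorem Expr.cost_add_cost_bitCost_le {b B : ℕ} {s : State} (hs : s.BddBy (2 ^ b)) {x y : Expr}
    (hxy : max x.maxConst y.maxConst ≤ 2 ^ b) (hB : b + (x.size + y.size) ≤ B) :
    x.cost bitCost s + y.cost bitCost s + 1 ≤ (x.size + y.size + 1) * (B + 2) := by
  have hx := cost_bitCost_le (B := B) hs (max_le_iff.1 hxy).1 (by omega)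
  have hy := cost_bitCost_le (B := B) hs (max_le_iff.1 hxy).2 (by omega)
  linarith

/-- Each operation at most doubles the largest number in the machine. -/
theorem Runs.bddBy {P : Prog} {s s' : State} {t b : ℕ} (h : Runs unitCost P s t s')
    (hs : s.BddBy (2 ^ b)) (hP : P.maxConst ≤ 2 ^ b) : s'.BddBy (2 ^ (b + t)) := by
  induction h generalizing b with
  | skip | loop_done => exact hs.mono (two_pow_mono (Nat.le_add_right _ _))
  | set r e s =>
    rw [Expr.cost_unitCost]
    have hs' := hs.mono (two_pow_mono (Nat.le_add_right b (e.size + 1)))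
    exact ⟨update_le hs'.1 ((Expr.eval_le hs hP).trans (two_pow_mono (by omega))), hs'.2⟩
  | store a e s =>
    rw [Expr.cost_unitCost, Expr.cost_unitCost]
    have hs' := hs.mono (two_pow_mono (Nat.le_add_right b (a.size + e.size + 1)))
    exact ⟨hs'.1, update_le hs'.2
      ((Expr.eval_le hs (max_le_iff.1 hP).2).trans (two_pow_mono (by omega)))⟩
  | seq _ _ ih₁ ih₂ =>
    obtain ⟨hP₁, hP₂⟩ := max_le_iff.1 hP
    rw [← Nat.add_assoc]
    exact ih₂ (ih₁ hs hP₁) (hP₂.trans (two_pow_mono (Nat.le_add_right _ _)))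
  | cond_true _ _ ih =>
    exact (ih hs (max_le_iff.1 (max_le_iff.1 hP).2).1).mono (two_pow_mono (by omega))
  | cond_false _ _ ih =>
    exact (ih hs (max_le_iff.1 (max_le_iff.1 hP).2).2).mono (two_pow_mono (by omega))
  | loop_step _ _ _ ih₁ ih₂ =>
    exact (ih₂ (ih₁ hs (max_le_iff.1 hP).2) (hP.trans (two_pow_mono (Nat.le_add_right _ _)))).mono
      (two_pow_mono (by omega))

theorem Runs.exists_bitCost_le {P : Prog} {s s' : State} {t b B : ℕ} (h : Runs unitCost P s t s')
    (hs : s.BddBy (2 ^ b)) (hP : P.maxConst ≤ 2 ^ b) (hB : b + t ≤ B) :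
    ∃ t', Runs bitCost P s t' s' ∧ t' ≤ t * (B + 2) := by
  induction h generalizing b with
  | skip s => exact ⟨1, .skip s, by omega⟩
  | set r e s =>
    rw [Expr.cost_unitCost] at hB ⊢
    have he := Expr.cost_bitCost_le (B := B) hs hP (by omega)
    exact ⟨_, .set r e s, by linarith⟩
  | store a e s =>
    rw [Expr.cost_unitCost, Expr.cost_unitCost] at hB ⊢
    exact ⟨_, .store a e s, Expr.cost_add_cost_bitCost_le hs hP (by omega)⟩
  | seq h₁ _ ih₁ ih₂ =>
    obtain ⟨hP₁, hP₂⟩ := max_le_iff.1 hP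
    obtain ⟨u₁, hr₁, hu₁⟩ := ih₁ hs hP₁ (by omega)
    obtain ⟨u₂, hr₂, hu₂⟩ := ih₂ (h₁.bddBy hs hP₁)
      (hP₂.trans (two_pow_mono (Nat.le_add_right _ _))) (by omega)
    exact ⟨_, .seq hr₁ hr₂, by linarith⟩
  | cond_true hxy _ ih =>
    obtain ⟨hP', hPQ⟩ := max_le_iff.1 hP
    rw [Expr.cost_unitCost, Expr.cost_unitCost] at hB ⊢
    have htest := Expr.cost_add_cost_bitCost_le (B := B) hs hP' (by omega)
    obtain ⟨u, hr, hu⟩ := ih hs (max_le_iff.1 hPQ).1 (by omega)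
    exact ⟨_, .cond_true hxy hr, by linarith⟩
  | cond_false hxy _ ih =>
    obtain ⟨hP', hPQ⟩ := max_le_iff.1 hP
    rw [Expr.cost_unitCost, Expr.cost_unitCost] at hB ⊢
    have htest := Expr.cost_add_cost_bitCost_le (B := B) hs hP' (by omega)
    obtain ⟨u, hr, hu⟩ := ih hs (max_le_iff.1 hPQ).2 (by omega)
    exact ⟨_, .cond_false hxy hr, by linarith⟩
  | loop_done hxy =>
    rw [Expr.cost_unitCost, Expr.cost_unitCost] at hB ⊢
    exact ⟨_, .loop_done hxy, Expr.cost_add_cost_bitCost_le hs (max_le_iff.1 hP).1 (by omega)⟩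
  | loop_step hxy h₁ _ ih₁ ih₂ =>
    obtain ⟨hP', hP₁⟩ := max_le_iff.1 hP
    rw [Expr.cost_unitCost, Expr.cost_unitCost] at hB ⊢
    have htest := Expr.cost_add_cost_bitCost_le (B := B) hs hP' (by omega)
    obtain ⟨u₁, hr₁, hu₁⟩ := ih₁ hs hP₁ (by omega)
    obtain ⟨u₂, hr₂, hu₂⟩ := ih₂ (h₁.bddBy hs hP₁)
      (hP.trans (two_pow_mono (Nat.le_add_right _ _))) (by omega)
    exact ⟨_, .loop_step hxy hr₁ hr₂, by linarith⟩

theorem le_two_pow_of_bitCost_le {v L : ℕ} (h : bitCost v ≤ L) : v ≤ 2 ^ L :=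
  (Nat.lt_size_self v).le.trans (two_pow_mono ((Nat.le_succ _).trans h))

namespace Instance

variable {n : ℕ} (I : Instance n)

theorem job_le_inputLength (j : Fin n) :
    bitCost (I.p j) + bitCost (I.d j) + bitCost (I.w j) ≤ I.inputLength :=
  (single_le_sum (f := fun j => bitCost (I.p j) + bitCost (I.d j) + bitCost (I.w j))
    (fun _ _ => Nat.zero_le _) (mem_univ j)).trans (Nat.le_add_left _ _)

theorem le_inputLength : n ≤ I.inputLength := by
  calc n = ∑ _j : Fin n, 1 := by rw [sum_const, card_univ, Fintype.card_fin, smul_eq_mul, mul_one]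
    _ ≤ ∑ j, (bitCost (I.p j) + bitCost (I.d j) + bitCost (I.w j)) :=
      sum_le_sum fun j _ => by rw [bitCost]; omega
    _ ≤ I.inputLength := Nat.le_add_left _ _

theorem initialState_bddBy : I.initialState.BddBy (2 ^ I.inputLength) := by
  refine ⟨fun _ => Nat.zero_le _, fun a => ?_⟩
  simp only [initialState]
  split_ifs with h₀ hj
  · exact le_two_pow_of_bitCost_le (Nat.le_add_right _ _)
  · exact le_two_pow_of_bitCost_le (by have := I.job_le_inputLength ⟨_, hj⟩; omega)
  · exact le_two_pow_of_bitCost_le (by have := I.job_le_inputLength ⟨_, hj⟩; omega)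
  · exact le_two_pow_of_bitCost_le (by have := I.job_le_inputLength ⟨_, hj⟩; omega)
  · exact Nat.zero_le _

end Instance

theorem Prog.RunsInTime.polyTimeForConstant {P : Prog} {ν : ∀ {n : ℕ}, Instance n → ℕ}
    (h : P.RunsInTime ν) : P.PolyTimeForConstant ν := by
  intro k
  obtain ⟨C, hC⟩ := h
  let T : Polynomial ℕ := .C C * (.X ^ (k + 1) * .X + 1)
  refine ⟨T * (.X + .C P.maxConst + T + 2), fun n I hI => ?_⟩
  obtain ⟨t, s, hr, ht⟩ := hC n I
  set L := I.inputLength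
  have hn : n ≤ L := I.le_inputLength
  have hL1 : 1 ≤ L := (Nat.succ_le_succ (Nat.zero_le _)).trans (Nat.le_add_right (bitCost n) _)
  have htT : t ≤ T.eval L := by
    simp only [T, Polynomial.eval_mul, Polynomial.eval_add, Polynomial.eval_C, Polynomial.eval_pow,
      Polynomial.eval_X, Polynomial.eval_one]
    refine ht.trans (Nat.mul_le_mul_left _ (Nat.add_le_add_right (Nat.mul_le_mul ?_ ?_) 1))
    · exact (Nat.pow_le_pow_left hn _).trans (Nat.pow_le_pow_right hL1 (Nat.add_le_add_right hI 1))
    · exact (Nat.log_le_self 2 n).trans hn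
  obtain ⟨t', hr', ht'⟩ := hr.exists_bitCost_le (b := L + P.maxConst)
    (B := L + P.maxConst + T.eval L) (I.initialState_bddBy.mono (two_pow_mono (by omega)))
    (Nat.lt_two_pow_self.le.trans (two_pow_mono (by omega))) (by omega)
  refine ⟨t', s, hr', ht'.trans ?_⟩
  simp only [Polynomial.eval_mul, Polynomial.eval_add, Polynomial.eval_C, Polynomial.eval_X,
    Polynomial.eval_ofNat]
  exact Nat.mul_le_mul_right _ htT

/-! ### The dynamic program -/

/-- The data of the jobs `0, 1, 2, …`: processing times, due dates and weights. In the dynamic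
program the jobs are numbered by non-decreasing due dates, and jobs beyond the last one are never
looked at. -/
structure Jobs where
  p : ℕ → ℕ
  d : ℕ → ℕ
  w : ℕ → ℕ

/-- An entry of the table: `tag` is `0` if no set of jobs is recorded, `1` if the recorded set does
not contain the last job considered, and `2` if it does; `time` and `weight` are the total
processing time and the total weight of the recorded set. -/
structure Entry where
  tag : ℕ
  time : ℕ
  weight : ℕ

/-- The entry that records no set. -/
def Entry.none : Entry := ⟨0, 0, 0⟩

/-- The entry resulting from the option `o` of leaving out a job with data `p`, `d`, `w` and the
option `c` of adding the job to the set recorded in `c`; the larger value of weight minus time is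
preferred. -/
def Entry.step (p d w : ℕ) (o c : Entry) : Entry :=
  if 0 < c.tag ∧ c.time + p ≤ d ∧
      (0 < o.tag → c.time + p + o.weight < o.time + (c.weight + w)) then
    ⟨2, c.time + p, c.weight + w⟩
  else ⟨min o.tag 1, o.time, o.weight⟩

theorem Entry.step_of_leave {p d w : ℕ} {o : Entry} (c : Entry) (ho : 0 < o.tag) :
    0 < (step p d w o c).tag ∧
      o.weight + (step p d w o c).time ≤ (step p d w o c).weight + o.time := by
  unfold step
  split_ifs with h
  · have := h.2.2 ho
    exact ⟨two_pos, by dsimp only; omega⟩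
  · exact ⟨lt_min ho one_pos, le_rfl⟩

theorem Entry.step_of_add {p d w : ℕ} (o : Entry) {c : Entry} (hc : 0 < c.tag)
    (hd : c.time + p ≤ d) :
    0 < (step p d w o c).tag ∧
      c.weight + w + (step p d w o c).time ≤ (step p d w o c).weight + (c.time + p) := by
  unfold step
  split_ifs with h
  · exact ⟨two_pos, le_rfl⟩
  · simp only [hc, hd, true_and, Classical.not_imp, not_lt] at h
    exact ⟨lt_min h.1 one_pos, by dsimp only; omega⟩

/-- The sum of the keys `κ` over a set of jobs before `n` determines the sum of the values `v`. -/
def KeyFor (κ v : ℕ → ℕ) (n : ℕ) : Prop :=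
  ∀ S ⊆ range n, ∀ T ⊆ range n, ∑ i ∈ S, κ i = ∑ i ∈ T, κ i → ∑ i ∈ S, v i = ∑ i ∈ T, v i

namespace Jobs

variable (J : Jobs) (κ : ℕ → ℕ)

/-- The jobs of `S` all meet their due dates when they are processed first, in their order. -/
def Feasible (S : Finset ℕ) : Prop := ∀ j ∈ S, ∑ i ∈ S with i ≤ j, J.p i ≤ J.d j

/-- The table of the dynamic program, for sets of jobs among the first `r` whose keys sum to `x`. -/
def table : ℕ → ℕ → Entry
  | 0, x => if x = 0 then ⟨1, 0, 0⟩ else .none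
  | r + 1, x => .step (J.p r) (J.d r) (J.w r) (table r x)
      (if κ r ≤ x then table r (x - κ r) else .none)

/-- The set of jobs that is recorded in an entry of the table. -/
def trace : ℕ → ℕ → Finset ℕ
  | 0, _ => ∅
  | r + 1, x =>
    if 1 < (J.table κ (r + 1) x).tag then insert r (trace r (x - κ r)) else trace r x

variable {J κ}

theorem feasible_insert {r : ℕ} {S : Finset ℕ} (hS : S ⊆ range r) :
    J.Feasible (insert r S) ↔ J.Feasible S ∧ ∑ i ∈ S, J.p i + J.p r ≤ J.d r := by
  have hr : r ∉ S := fun h => by simpa using hS h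
  have hlt : ∀ i ∈ S, i < r := fun i hi => mem_range.1 (hS hi)
  have hsum_r : ∑ i ∈ insert r S with i ≤ r, J.p i = ∑ i ∈ S, J.p i + J.p r := by
    rw [filter_true_of_mem, sum_insert hr, Nat.add_comm]
    exact forall_mem_insert _ _ _ |>.2 ⟨le_rfl, fun i hi => (hlt i hi).le⟩
  have hsum_lt (j) (hj : j ∈ S) :
      ∑ i ∈ insert r S with i ≤ j, J.p i = ∑ i ∈ S with i ≤ j, J.p i := by
    rw [filter_insert, if_neg (not_le.2 (hlt j hj))]
  rw [Feasible, forall_mem_insert, hsum_r, and_comm]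
  exact and_congr_left' (forall₂_congr fun j hj => by rw [hsum_lt j hj])

theorem trace_subset (r x : ℕ) : J.trace κ r x ⊆ range r := by
  induction r generalizing x with
  | zero => exact empty_subset _
  | succ r ih =>
    have hr : range r ⊆ range (r + 1) := range_subset_range.2 (Nat.le_succ r)
    rw [trace]
    split_ifs
    · exact insert_subset (self_mem_range_succ r) ((ih _).trans hr)
    · exact (ih _).trans hr

theorem notMem_trace (r x : ℕ) : r ∉ J.trace κ r x :=
  fun h => notMem_range_self (trace_subset r x h)

theorem table_succ_cases (J : Jobs) (κ : ℕ → ℕ) (r x : ℕ) :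
    (κ r ≤ x ∧ 0 < (J.table κ r (x - κ r)).tag ∧
      (J.table κ r (x - κ r)).time + J.p r ≤ J.d r ∧
      J.trace κ (r + 1) x = insert r (J.trace κ r (x - κ r)) ∧
      J.table κ (r + 1) x = ⟨2, (J.table κ r (x - κ r)).time + J.p r,
        (J.table κ r (x - κ r)).weight + J.w r⟩) ∨
    (J.trace κ (r + 1) x = J.trace κ r x ∧
      J.table κ (r + 1) x = ⟨min (J.table κ r x).tag 1, (J.table κ r x).time,
        (J.table κ r x).weight⟩) := by
  rw [trace, table, Entry.step]
  split_ifs with hx h₁ h₂ h₁ h₂ h₁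
  · exact .inl ⟨hx, h₁.1, h₁.2.1, rfl, rfl⟩
  all_goals simp_all [Entry.none]

theorem sum_trace (r x : ℕ) :
    J.Feasible (J.trace κ r x) ∧
      ∑ i ∈ J.trace κ r x, J.p i = (J.table κ r x).time ∧
      ∑ i ∈ J.trace κ r x, J.w i = (J.table κ r x).weight := by
  induction r generalizing x with
  | zero =>
    simp only [table, Entry.none]
    split_ifs <;> exact ⟨fun j hj => absurd hj (notMem_empty j), rfl, rfl⟩
  | succ r ih =>
    obtain ⟨-, -, hd, htrace, htable⟩ | ⟨htrace, htable⟩ := J.table_succ_cases κ r x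
    · obtain ⟨hf, hp, hw⟩ := ih (x - κ r)
      rw [htrace, htable, feasible_insert (trace_subset _ _), sum_insert (notMem_trace _ _),
        sum_insert (notMem_trace _ _), hp, hw]
      exact ⟨⟨hf, hd⟩, Nat.add_comm _ _, Nat.add_comm _ _⟩
    · rw [htrace, htable]
      exact ih x

theorem sum_key_trace {r x : ℕ} (h : 0 < (J.table κ r x).tag) :
    ∑ i ∈ J.trace κ r x, κ i = x := by
  induction r generalizing x with
  | zero =>
    rw [table] at h
    split_ifs at h with hx
    · exact hx.symm
    · exact absurd h (Nat.lt_irrefl 0)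
  | succ r ih =>
    obtain ⟨hx, hc, -, htrace, -⟩ | ⟨htrace, htable⟩ := J.table_succ_cases κ r x
    · rw [htrace, sum_insert (notMem_trace _ _), ih hc, Nat.add_sub_cancel' hx]
    · rw [htable] at h
      rw [htrace, ih (lt_min_iff.1 h).1]

/-- As the sum of keys determines the time or the weight, the set that maximizes weight minus time
for a given sum of keys is optimal in both respects. -/
theorem dominates_of_weight_sub_time {n r x : ℕ} (hκ : KeyFor κ J.p n ∨ KeyFor κ J.w n)
    (hr : r ≤ n) {S : Finset ℕ} (hS : S ⊆ range r) (hx : ∑ i ∈ S, κ i = x)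
    (htag : 0 < (J.table κ r x).tag)
    (h : ∑ i ∈ S, J.w i + (J.table κ r x).time ≤ (J.table κ r x).weight + ∑ i ∈ S, J.p i) :
    (J.table κ r x).time ≤ ∑ i ∈ S, J.p i ∧ ∑ i ∈ S, J.w i ≤ (J.table κ r x).weight := by
  obtain ⟨-, hp, hw⟩ := sum_trace (J := J) (κ := κ) r x
  have hsub : range r ⊆ range n := range_subset_range.2 hr
  have hkey : ∑ i ∈ S, κ i = ∑ i ∈ J.trace κ r x, κ i := hx.trans (sum_key_trace htag).symm
  rcases hκ with hκ | hκ
  · have := hκ _ (hS.trans hsub) _ ((trace_subset _ _).trans hsub) hkey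
    omega
  · have := hκ _ (hS.trans hsub) _ ((trace_subset _ _).trans hsub) hkey
    omega

theorem table_dominates {n r : ℕ} (hκ : KeyFor κ J.p n ∨ KeyFor κ J.w n) (hr : r ≤ n)
    {S : Finset ℕ} (hS : S ⊆ range r) (hf : J.Feasible S) :
    0 < (J.table κ r (∑ i ∈ S, κ i)).tag ∧
      (J.table κ r (∑ i ∈ S, κ i)).time ≤ ∑ i ∈ S, J.p i ∧
      ∑ i ∈ S, J.w i ≤ (J.table κ r (∑ i ∈ S, κ i)).weight := by
  induction r generalizing S with
  | zero =>
    obtain rfl : S = ∅ := subset_empty.1 hS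
    exact ⟨one_pos, le_rfl, le_rfl⟩
  | succ r ih =>
    suffices H : 0 < (J.table κ (r + 1) (∑ i ∈ S, κ i)).tag ∧
        ∑ i ∈ S, J.w i + (J.table κ (r + 1) (∑ i ∈ S, κ i)).time ≤
          (J.table κ (r + 1) (∑ i ∈ S, κ i)).weight + ∑ i ∈ S, J.p i from
      ⟨H.1, dominates_of_weight_sub_time hκ hr hS rfl H.1 H.2⟩
    rw [range_add_one] at hS
    by_cases hrS : r ∈ S
    · have hT : S.erase r ⊆ range r := subset_insert_iff.1 hS
      rw [← insert_erase hrS, feasible_insert hT] at hf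
      obtain ⟨htag, htime, hweight⟩ := ih (Nat.le_of_succ_le hr) hT hf.1
      rw [← add_sum_erase _ κ hrS, ← add_sum_erase _ J.p hrS, ← add_sum_erase _ J.w hrS, table,
        if_pos (Nat.le_add_right _ _), Nat.add_sub_cancel_left]
      obtain ⟨htag', h⟩ := Entry.step_of_add (w := J.w r)
        (J.table κ r (κ r + ∑ i ∈ S.erase r, κ i)) htag
        ((Nat.add_le_add_right htime _).trans hf.2)
      exact ⟨htag', by omega⟩
    · obtain ⟨htag, htime, hweight⟩ :=
        ih (Nat.le_of_succ_le hr) ((subset_insert_iff_of_notMem hrS).1 hS) hf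
      rw [table]
      refine ⟨(Entry.step_of_leave _ htag).1, ?_⟩
      have h := (Entry.step_of_leave (p := J.p r) (d := J.d r) (w := J.w r)
        (if κ r ≤ ∑ i ∈ S, κ i then J.table κ r (∑ i ∈ S, κ i - κ r) else .none) htag).2
      omega

/-- `S` is a feasible set of maximal weight among the jobs before `n`. -/
def IsMaxFeasible (J : Jobs) (n : ℕ) (S : Finset ℕ) : Prop :=
  J.Feasible S ∧ ∀ T ⊆ range n, J.Feasible T → ∑ i ∈ T, J.w i ≤ ∑ i ∈ S, J.w i

theorem isMaxFeasible_trace {n N b : ℕ} (hκ : KeyFor κ J.p n ∨ KeyFor κ J.w n)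
    (hN : ∑ i ∈ range n, κ i < N)
    (hb : ∀ x < N, (J.table κ n x).weight ≤ (J.table κ n b).weight) :
    J.IsMaxFeasible n (J.trace κ n b) := by
  refine ⟨(sum_trace n b).1, fun T hT hf => ?_⟩
  calc ∑ i ∈ T, J.w i ≤ (J.table κ n (∑ i ∈ T, κ i)).weight := (table_dominates hκ le_rfl hT hf).2.2
    _ ≤ (J.table κ n b).weight := hb _ ((sum_le_sum_of_subset hT).trans_lt hN)
    _ = ∑ i ∈ J.trace κ n b, J.w i := (sum_trace n b).2.2.symm

end Jobs

/-! ### Keys -/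

theorem sum_pow_eq_finFunctionFinEquiv {ι : Type*} {n m : ℕ} {e : ι → ℕ} {S : Finset ι}
    (hS : #S ≤ n) (he : ∀ i ∈ S, e i < m) :
    ∑ i ∈ S, (n + 1) ^ e i = (finFunctionFinEquiv fun c : Fin m =>
      (⟨#{i ∈ S | e i = c}, Nat.lt_succ_of_le ((card_filter_le _ _).trans hS)⟩ : Fin (n + 1))) := by
  rw [finFunctionFinEquiv_apply,
    Fin.sum_univ_eq_sum_range fun c => #{i ∈ S | e i = c} * (n + 1) ^ c,
    ← sum_fiberwise_of_maps_to (t := range m) (g := e) fun i hi => mem_range.2 (he i hi)]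
  refine sum_congr rfl fun c _ => ?_
  rw [sum_congr rfl fun i hi => by rw [(mem_filter.1 hi).2], sum_const, smul_eq_mul]

/-- The sum of the powers `(n + 1) ^ e i` over a set of at most `n` elements lists, as its digits in
base `n + 1`, the numbers of elements in the classes of `e`. -/
theorem card_filter_eq_of_sum_pow_eq {ι : Type*} {n m : ℕ} {e : ι → ℕ} {S T : Finset ι}
    (hS : #S ≤ n) (hT : #T ≤ n) (heS : ∀ i ∈ S, e i < m) (heT : ∀ i ∈ T, e i < m)
    (h : ∑ i ∈ S, (n + 1) ^ e i = ∑ i ∈ T, (n + 1) ^ e i) {c : ℕ} (hc : c < m) :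
    #{i ∈ S | e i = c} = #{i ∈ T | e i = c} := by
  rw [sum_pow_eq_finFunctionFinEquiv hS heS, sum_pow_eq_finFunctionFinEquiv hT heT,
    Fin.val_inj, finFunctionFinEquiv.apply_eq_iff_eq] at h
  exact congrArg Fin.val (congrFun h ⟨c, hc⟩)

section ClassIdx

variable {α : Type*} [DecidableEq α] (v : ℕ → α)

/-- The first index with the same value of `v` as `i`. -/
def firstIdx (i : ℕ) : ℕ := Nat.find (p := fun k => v k = v i) ⟨i, rfl⟩

/-- The index of the value `v i` when the values of `v` are numbered in the order of their first
occurrence. -/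
def classIdx (i : ℕ) : ℕ := #((range (firstIdx v i)).image v)

variable {v}

theorem apply_firstIdx (i : ℕ) : v (firstIdx v i) = v i :=
  Nat.find_spec (p := fun k => v k = v i) ⟨i, rfl⟩

theorem apply_notMem_image_firstIdx (i : ℕ) : v i ∉ (range (firstIdx v i)).image v := by
  rw [mem_image]
  rintro ⟨k, hk, hki⟩
  exact Nat.find_min _ (mem_range.1 hk) hki

theorem firstIdx_le (i : ℕ) : firstIdx v i ≤ i := Nat.find_le rfl

theorem firstIdx_congr {i j : ℕ} (h : v i = v j) : firstIdx v i = firstIdx v j := by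
  simp only [firstIdx, h]

theorem classIdx_congr {i j : ℕ} (h : v i = v j) : classIdx v i = classIdx v j := by
  rw [classIdx, classIdx, firstIdx_congr h]

theorem classIdx_of_notMem {i : ℕ} (h : v i ∉ (range i).image v) :
    classIdx v i = #((range i).image v) := by
  suffices firstIdx v i = i by rw [classIdx, this]
  refine (firstIdx_le i).antisymm (not_lt.1 fun hlt => h ?_)
  exact mem_image.2 ⟨_, mem_range.2 hlt, apply_firstIdx i⟩

theorem classIdx_lt {i m : ℕ} (hi : i < m) : classIdx v i < #((range m).image v) := by
  have hm : firstIdx v i ≤ m := (firstIdx_le i).trans hi.le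
  refine card_lt_card ⟨image_subset_image (range_subset_range.2 hm), fun h => ?_⟩
  exact apply_notMem_image_firstIdx i (h (mem_image_of_mem v (mem_range.2 hi)))

theorem classIdx_lt_classIdx {i j : ℕ} (h : firstIdx v i < firstIdx v j) :
    classIdx v i < classIdx v j :=
  (classIdx_congr (apply_firstIdx i)).symm.trans_lt (classIdx_lt h)

theorem classIdx_eq_iff {i j : ℕ} : classIdx v i = classIdx v j ↔ v i = v j := by
  refine ⟨fun h => ?_, classIdx_congr⟩
  rw [← apply_firstIdx (v := v) i, ← apply_firstIdx (v := v) j]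
  rcases lt_trichotomy (firstIdx v i) (firstIdx v j) with hlt | heq | hlt
  · exact absurd h (classIdx_lt_classIdx hlt).ne
  · rw [heq]
  · exact absurd h (classIdx_lt_classIdx hlt).ne'

end ClassIdx

theorem sum_pow_classIdx_lt {α : Type*} [DecidableEq α] (v : ℕ → α) (n : ℕ) :
    ∑ i ∈ range n, (n + 1) ^ classIdx v i < (n + 1) ^ #((range n).image v) := by
  rw [sum_pow_eq_finFunctionFinEquiv (card_range n).le fun i hi => classIdx_lt (mem_range.1 hi)]
  exact Fin.isLt _

theorem keyFor_pow_classIdx (v : ℕ → ℕ) (n : ℕ) : KeyFor (fun i => (n + 1) ^ classIdx v i) v n := by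
  intro S hS T hT h
  have hcard {U : Finset ℕ} (hU : U ⊆ range n) : #U ≤ n := (card_le_card hU).trans (card_range n).le
  have hlt {U : Finset ℕ} (hU : U ⊆ range n) (i) (hi : i ∈ U) :
      classIdx v i < #((range n).image v) := classIdx_lt (mem_range.1 (hU hi))
  have hsum {U : Finset ℕ} (hU : U ⊆ range n) :
      ∑ i ∈ U, v i = ∑ y ∈ (range n).image v, #{i ∈ U | v i = y} * y := by
    rw [← sum_fiberwise_of_maps_to (g := v) fun i hi => mem_image_of_mem v (hU hi)]
    exact sum_congr rfl fun y _ => sum_const_nat fun i hi => (mem_filter.1 hi).2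
  rw [hsum hS, hsum hT]
  refine sum_congr rfl (forall_mem_image.2 fun j hj => congrArg (· * v j) ?_)
  simp only [← classIdx_eq_iff (v := v)]
  exact card_filter_eq_of_sum_pow_eq (hcard hS) (hcard hT) (hlt hS) (hlt hT) h
    (classIdx_lt (mem_range.1 hj))

/-! ### Ranks and schedules -/

/-- The number of indices before `m` that come before `i` when the indices are ordered by the values
of `v`, ties being broken by the index. -/
def rank (v : ℕ → ℕ) (m i : ℕ) : ℕ := #{k ∈ range m | toLex (v k, k) < toLex (v i, i)}

section Rank

variable {v : ℕ → ℕ} {m n i j : ℕ}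

theorem rank_succ (v : ℕ → ℕ) (m i : ℕ) :
    rank v (m + 1) i = rank v m i + if toLex (v m, m) < toLex (v i, i) then 1 else 0 := by
  rw [rank, range_add_one, filter_insert]
  split_ifs
  · rw [card_insert_of_notMem (by simp), rank]
  · rfl

theorem rank_lt_rank (hi : i < n) (h : toLex (v i, i) < toLex (v j, j)) :
    rank v n i < rank v n j :=
  card_lt_card (ssubset_iff_of_subset (monotone_filter_right _ fun _ _ hk => hk.trans h) |>.2
    ⟨i, mem_filter.2 ⟨mem_range.2 hi, h⟩, fun h' => lt_irrefl _ (mem_filter.1 h').2⟩)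

theorem rank_le_rank_iff (hi : i < n) (hj : j < n) :
    rank v n i ≤ rank v n j ↔ toLex (v i, i) ≤ toLex (v j, j) := by
  refine ⟨fun h => not_lt.1 fun h' => (rank_lt_rank hj h').not_ge h, fun h => ?_⟩
  rcases h.eq_or_lt with h | h
  · rw [(Prod.mk.inj (toLex.injective h)).2]
  · exact (rank_lt_rank hi h).le

theorem rank_lt (hi : i < n) : rank v n i < n :=
  calc rank v n i < #(range n) :=
        card_lt_card (filter_ssubset.2 ⟨i, mem_range.2 hi, lt_irrefl (toLex (v i, i))⟩)
    _ = n := card_range n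

theorem rank_injOn : Set.InjOn (rank v n) (Set.Iio n) := fun _ hi _ hj h =>
  (Prod.mk.inj (toLex.injective (((rank_le_rank_iff hi hj).1 h.le).antisymm
    ((rank_le_rank_iff hj hi).1 h.ge)))).2

variable (v n) in
/-- The permutation that sends an index to its rank. -/
noncomputable def rankPerm : Equiv.Perm (Fin n) :=
  .ofBijective (fun i => ⟨rank v n i, rank_lt i.2⟩) (Finite.injective_iff_bijective.1 fun i j h =>
    Fin.ext (rank_injOn i.2 j.2 (Fin.val_eq_of_eq h)))

theorem rankPerm_le_rankPerm_iff {i j : Fin n} :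
    rankPerm v n i ≤ rankPerm v n j ↔ toLex (v i, (i : ℕ)) ≤ toLex (v j, (j : ℕ)) :=
  rank_le_rank_iff i.2 j.2

end Rank

namespace Instance

variable {n : ℕ} (I : Instance n)

/-- The jobs ordered by non-decreasing due dates. -/
noncomputable def eddOrder : Equiv.Perm (Fin n) := rankPerm (Function.extend Fin.val I.d 0) n

/-- The jobs of `I`, numbered by non-decreasing due dates. -/
noncomputable def eddJobs : Jobs where
  p := Function.extend (fun j => (I.eddOrder j : ℕ)) I.p 0
  d := Function.extend (fun j => (I.eddOrder j : ℕ)) I.d 0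
  w := Function.extend (fun j => (I.eddOrder j : ℕ)) I.w 0

/-- The schedule in which the jobs of `T`, given by their numbers in the order of the due dates,
come first and the other jobs come last, with ties broken by due dates. -/
noncomputable def schedule (T : Finset ℕ) : Equiv.Perm (Fin n) :=
  I.eddOrder.trans (rankPerm (fun r => if r ∈ T then 0 else 1) n)

/-- The set of early jobs of a schedule, given by their numbers in the order of the due dates. -/
noncomputable def earlySet (σ : Equiv.Perm (Fin n)) : Finset ℕ :=
  ({j | I.completionTime σ j ≤ I.d j} : Finset (Fin n)).image fun j => (I.eddOrder j : ℕ)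

variable {I}

theorem eddOrder_val_injective : Function.Injective fun j => (I.eddOrder j : ℕ) :=
  Fin.val_injective.comp I.eddOrder.injective

theorem eddJobs_p (j : Fin n) : I.eddJobs.p (I.eddOrder j) = I.p j :=
  eddOrder_val_injective.extend_apply _ _ j

theorem eddJobs_d (j : Fin n) : I.eddJobs.d (I.eddOrder j) = I.d j :=
  eddOrder_val_injective.extend_apply _ _ j

theorem eddJobs_w (j : Fin n) : I.eddJobs.w (I.eddOrder j) = I.w j :=
  eddOrder_val_injective.extend_apply _ _ j

theorem d_le_d_of_eddOrder_le {i j : Fin n} (h : I.eddOrder i ≤ I.eddOrder j) : I.d i ≤ I.d j := by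
  have h' := rankPerm_le_rankPerm_iff.1 h
  rw [Fin.val_injective.extend_apply, Fin.val_injective.extend_apply, Prod.Lex.toLex_le_toLex] at h'
  exact h'.elim le_of_lt fun h => h.1.le

theorem exists_eddOrder_eq {r : ℕ} (hr : r < n) : ∃ j, (I.eddOrder j : ℕ) = r :=
  ⟨I.eddOrder.symm ⟨r, hr⟩, by rw [Equiv.apply_symm_apply]⟩

theorem image_eddOrder : univ.image (fun j => (I.eddOrder j : ℕ)) = range n := by
  ext r
  simp only [mem_image, mem_univ, true_and, mem_range]
  exact ⟨fun ⟨j, hj⟩ => hj ▸ (I.eddOrder j).2, exists_eddOrder_eq⟩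

theorem card_image_eddJobs_p : #((range n).image I.eddJobs.p) = I.numProcTimes := by
  rw [← image_eddOrder (I := I), image_image, numProcTimes]
  exact congrArg card (image_congr fun j _ => eddJobs_p j)

theorem card_image_eddJobs_w : #((range n).image I.eddJobs.w) = I.numWeights := by
  rw [← image_eddOrder (I := I), image_image, numWeights]
  exact congrArg card (image_congr fun j _ => eddJobs_w j)

theorem sum_image_eddJobs_p (A : Finset (Fin n)) :
    ∑ r ∈ A.image (fun j => (I.eddOrder j : ℕ)), I.eddJobs.p r = ∑ j ∈ A, I.p j := by
  rw [sum_image eddOrder_val_injective.injOn]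
  exact sum_congr rfl fun j _ => eddJobs_p j

theorem sum_image_eddJobs_w (A : Finset (Fin n)) :
    ∑ r ∈ A.image (fun j => (I.eddOrder j : ℕ)), I.eddJobs.w r = ∑ j ∈ A, I.w j := by
  rw [sum_image eddOrder_val_injective.injOn]
  exact sum_congr rfl fun j _ => eddJobs_w j

theorem tardyWeight_add_sum_earlySet (σ : Equiv.Perm (Fin n)) :
    I.tardyWeight σ + ∑ r ∈ I.earlySet σ, I.eddJobs.w r = ∑ j, I.w j := by
  rw [earlySet, sum_image_eddJobs_w, tardyWeight]
  simp only [← not_lt]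
  exact sum_filter_add_sum_filter_not univ _ _

/-- Among the early jobs up to `j` in the order of the due dates, the one that is processed last
completes after all of them, and its due date is at most that of `j`. -/
theorem feasible_earlySet (σ : Equiv.Perm (Fin n)) : I.eddJobs.Feasible (I.earlySet σ) := by
  refine forall_mem_image.2 fun j hj => ?_
  set A : Finset (Fin n) := {i | I.completionTime σ i ≤ I.d i ∧ I.eddOrder i ≤ I.eddOrder j} with hA
  have hjA : j ∈ A := by simpa [hA] using hj
  obtain ⟨m, hm, hmax⟩ := A.exists_max_image σ ⟨j, hjA⟩
  obtain ⟨-, hm_early, hmj⟩ := mem_filter.1 hm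
  calc ∑ r ∈ I.earlySet σ with r ≤ (I.eddOrder j : ℕ), I.eddJobs.p r = ∑ i ∈ A, I.p i := by
        rw [earlySet, filter_image, sum_image_eddJobs_p, filter_filter]
        rfl
    _ ≤ I.completionTime σ m :=
        sum_le_sum_of_subset fun i hi => mem_filter.2 ⟨mem_univ i, hmax i hi⟩
    _ ≤ I.d m := hm_early
    _ ≤ I.d j := d_le_d_of_eddOrder_le hmj
    _ = I.eddJobs.d (I.eddOrder j) := (eddJobs_d j).symm

theorem subset_earlySet_schedule {T : Finset ℕ} (hT : T ⊆ range n) (hf : I.eddJobs.Feasible T) :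
    T ⊆ I.earlySet (I.schedule T) := by
  intro r hr
  obtain ⟨j, rfl⟩ := exists_eddOrder_eq (I := I) (mem_range.1 (hT hr))
  refine mem_image_of_mem _ (mem_filter.2 ⟨mem_univ j, ?_⟩)
  rw [completionTime, ← sum_image_eddJobs_p, ← eddJobs_d]
  refine (sum_le_sum_of_subset (image_subset_iff.2 fun i hi => ?_)).trans (hf _ hr)
  have hle := rankPerm_le_rankPerm_iff.1 (mem_filter.1 hi).2
  rw [if_pos hr, Prod.Lex.toLex_le_toLex] at hle
  by_cases hi : (I.eddOrder i : ℕ) ∈ T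
  · rw [if_pos hi] at hle
    exact mem_filter.2 ⟨hi, (hle.resolve_left (lt_irrefl 0)).2⟩
  · simp [hi] at hle

theorem isOptimal_schedule {T : Finset ℕ} (hT : T ⊆ range n) (h : I.eddJobs.IsMaxFeasible n T) :
    I.IsOptimal (I.schedule T) := by
  intro σ
  have hσ : ∑ r ∈ I.earlySet σ, I.eddJobs.w r ≤ ∑ r ∈ T, I.eddJobs.w r :=
    h.2 _ (image_subset_iff.2 fun j _ => mem_range.2 (I.eddOrder j).2) (feasible_earlySet σ)
  have hT := sum_le_sum_of_subset (f := I.eddJobs.w) (subset_earlySet_schedule hT h.1)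
  have hadd := tardyWeight_add_sum_earlySet (I := I) (I.schedule T)
  have hadd' := tardyWeight_add_sum_earlySet (I := I) σ
  omega

end Instance

open Function

/-! ### The program -/

namespace Reg

abbrev jobs : ℕ := 0
abbrev i : ℕ := 1
abbrev k : ℕ := 2
abbrev rank : ℕ := 3
abbrev width : ℕ := 4
abbrev key : ℕ := 5
abbrev sum : ℕ := 6
abbrev ptr : ℕ := 7
abbrev tag : ℕ := 8
abbrev time : ℕ := 9
abbrev weight : ℕ := 10
abbrev row : ℕ := 11
abbrev col : ℕ := 12
abbrev cand : ℕ := 13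
abbrev best : ℕ := 14

end Reg

/-- The address of field `f` of record `e`. The memory above cell `0` is divided into records of
three cells, with fields `1`, `2`, `3`: first the data `p`, `d`, `w` of the jobs in the order of the
input, then, for each position in the order of the due dates, the index of the job, its key and its
output flag, and finally, row by row, the entries of the table of the dynamic program. -/
def cell (e : Expr) (f : ℕ) : Expr := .add (.add (.add e e) e) (.const f)

theorem eval_cell (s : State) (e : Expr) (f : ℕ) : (cell e f).eval s = 3 * e.eval s + f := by
  simp only [cell, Expr.eval]
  omega

/-- The address of field `f` of the record of the position in register `r`. -/
def sortedCell (r f : ℕ) : Expr := cell (.add (.reg Reg.jobs) (.reg r)) f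

theorem eval_sortedCell (s : State) (r f : ℕ) :
    (sortedCell r f).eval s = 3 * (s.reg Reg.jobs + s.reg r) + f := eval_cell _ _ _

/-- For each `i` before the number of jobs, store the value of `src` at the address `dst`, both of
which may refer to `i` and to its rank according to the values of `key`. -/
def scatter (key : ℕ → Expr) (dst src : Expr) : Prog :=
  forTo Reg.i Reg.jobs (
    .set Reg.rank (.const 0) ;;
    forTo Reg.k Reg.jobs (
      .cond (key Reg.k) (key Reg.i) (inc Reg.rank) (
        .cond (key Reg.i) (key Reg.k) .skip (
          .cond (.reg Reg.k) (.reg Reg.i) (inc Reg.rank) .skip))) ;;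
    .store dst src)

theorem exec_compare {key : ℕ → Expr} {v : ℕ → ℕ} {s : State} {i k : ℕ} (hi : s.reg Reg.i = i)
    (hk : s.reg Reg.k = k) (hki : (key Reg.i).eval s = v i) (hkk : (key Reg.k).eval s = v k) :
    (Prog.cond (key Reg.k) (key Reg.i) (inc Reg.rank) (
        .cond (key Reg.i) (key Reg.k) .skip (
          .cond (.reg Reg.k) (.reg Reg.i) (inc Reg.rank) .skip))).exec s =
      ⟨update s.reg Reg.rank (s.reg Reg.rank + if toLex (v k, k) < toLex (v i, i) then 1 else 0),
        s.mem⟩ := by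
  simp only [Prog.exec, inc, Expr.eval, hi, hk, hki, hkk, Prod.Lex.toLex_lt_toLex]
  split_ifs <;> first | simp_all <;> done | (exfalso; omega)

theorem ensures_scatter {key : ℕ → Expr} {dst src : Expr} {n : ℕ} {α v u : ℕ → ℕ} {s : State}
    (hn : s.reg Reg.jobs = n) (hα : Set.InjOn α (Set.Iio n))
    (hkey : ∀ s' : State, s'.reg Reg.jobs = n → (∀ a, (∀ r < n, a ≠ α r) → s'.mem a = s.mem a) →
      ∀ r, s'.reg r < n → (key r).eval s' = v (s'.reg r))
    (hdst : ∀ s' : State, s'.reg Reg.jobs = n → dst.eval s' = α (s'.reg Reg.rank))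
    (hsrc : ∀ s' : State, s'.reg Reg.jobs = n → (∀ a, (∀ r < n, a ≠ α r) → s'.mem a = s.mem a) →
      s'.reg Reg.i < n → src.eval s' = u (s'.reg Reg.i)) :
    Ensures (scatter key dst src) ((n + 1) * (n + 1)) (fun s' =>
      (∀ i < n, s'.mem (α (rank v n i)) = u i) ∧
      ∀ a, (∀ r < n, a ≠ α r) → s'.mem a = s.mem a) s := by
  refine ensures_forTo (fun k s' => (∀ i < k, s'.mem (α (rank v n i)) = u i) ∧
    ∀ a, (∀ r < n, a ≠ α r) → s'.mem a = s.mem a) (Nat.le_add_left 1 n) rfl rfl (by decide) hn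
    ⟨fun i hi => absurd hi i.not_lt_zero, fun a _ => rfl⟩ ?_
  rintro i hi s₁ hs₁ hi₁ ⟨hsto, hmem⟩
  have hn₁ : s₁.reg Reg.jobs = n := (hs₁.reg_eq rfl).trans hn
  refine .seq (.exec rfl (Nat.le_add_left 1 n) (.seq (.mono (ensures_forTo (N := n)
    (fun k s' => s'.reg Reg.rank = rank v k i) le_rfl rfl rfl (by decide) hn₁ rfl ?_)
    (Nat.one_mul _).le ?_)))
  · intro k hk s₂ hs₂ hk₂ hrank
    have hn₂ : s₂.reg Reg.jobs = n := (hs₂.reg_eq rfl).trans hn₁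
    have hi₂ : s₂.reg Reg.i = i := (hs₂.reg_eq rfl).trans hi₁
    have hkey₂ (r) (hr : s₂.reg r < n) : (key r).eval s₂ = v (s₂.reg r) :=
      hkey s₂ hn₂ (fun a ha => (congrFun (hs₂.mem_eq rfl) a).trans (hmem a ha)) r hr
    refine .exec rfl le_rfl ?_
    rw [exec_compare hi₂ hk₂ (hi₂ ▸ hkey₂ _ (hi₂ ▸ hi)) (hk₂ ▸ hkey₂ _ (hk₂ ▸ hk)), rank_succ,
      ← hrank]
    rfl
  · intro s₂ hs₂ hrank
    have hn₂ : s₂.reg Reg.jobs = n := (hs₂.reg_eq rfl).trans hn₁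
    have hi₂ : s₂.reg Reg.i = i := (hs₂.reg_eq rfl).trans hi₁
    have hmem₂ (a) (ha : ∀ r < n, a ≠ α r) : s₂.mem a = s.mem a :=
      (congrFun (hs₂.mem_eq rfl) a).trans (hmem a ha)
    refine .exec rfl (Nat.le_add_left 1 n) ⟨fun j hj => ?_, fun a ha => ?_⟩
    all_goals simp only [Prog.exec, hdst s₂ hn₂, hrank, hsrc s₂ hn₂ hmem₂ (hi₂ ▸ hi), hi₂]
    · rcases (Nat.lt_succ_iff_lt_or_eq.1 hj) with hj | rfl
      · have hji : rank v n j ≠ rank v n i := fun h => hj.ne (rank_injOn (hj.trans hi) hi h)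
        rw [update_of_ne fun h => hji (hα (rank_lt (hj.trans hi)) (rank_lt hi) h), hs₂.mem_eq rfl]
        exact hsto j hj
      · exact update_self ..
    · rw [update_of_ne (ha _ (rank_lt hi)), hmem₂ a ha]

/-! ### Computing the keys -/

/-- Field `f` of the input records holds the values `v` of the jobs in the order of the due
dates. -/
def Stored (v : ℕ → ℕ) (n f : ℕ) (m : ℕ → ℕ) : Prop :=
  ∀ q < n, m (3 * (n + q) + 1) < n ∧ m (3 * m (3 * (n + q) + 1) + f) = v q

theorem Stored.congr {v m m' : ℕ → ℕ} {n f : ℕ} (h : Stored v n f m) (hf : f ≤ 3)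
    (hm : ∀ a ≤ 6 * n, a ≤ 3 * n ∨ a % 3 = 1 → m' a = m a) : Stored v n f m' := by
  intro q hq
  obtain ⟨hidx, hv⟩ := h q hq
  rw [hm (3 * (n + q) + 1) (by omega) (by omega), hm _ (by omega) (by omega)]
  exact ⟨hidx, hv⟩

/-- Field `f` of the input record of the job in the position in register `r`. -/
def jobField (r f : ℕ) : Expr := .load (cell (.load (sortedCell r 1)) f)

theorem eval_jobField (s : State) (r f : ℕ) : (jobField r f).eval s =
    s.mem (3 * s.mem (3 * (s.reg Reg.jobs + s.reg r) + 1) + f) := by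
  rw [jobField, Expr.eval, eval_cell, Expr.eval, eval_sortedCell]

/-- Find the key of job `i`, which is the contents of register `width` unless an earlier job has the
same value in field `f`. -/
def findKey (f : ℕ) : Prog :=
  .set Reg.key (.reg Reg.width) ;;
  forTo Reg.k Reg.i (
    .cond (jobField Reg.k f) (jobField Reg.i f) .skip (
      .cond (jobField Reg.i f) (jobField Reg.k f) .skip (
        .set Reg.key (.load (sortedCell Reg.k 2)))))

theorem ensures_findKey {v : ℕ → ℕ} {n f i : ℕ} {s : State} (hn : s.reg Reg.jobs = n)
    (hsi : s.reg Reg.i = i) (hi : i < n) (hv : Stored v n f s.mem)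
    (hkeys : ∀ q < i, s.mem (3 * (n + q) + 2) = (n + 1) ^ classIdx v q)
    (hwidth : s.reg Reg.width = (n + 1) ^ #((range i).image v)) :
    Ensures (findKey f) (n + 1) (fun s' => s'.reg Reg.key = (n + 1) ^ classIdx v i) s := by
  refine .seq (.exec rfl (Nat.le_add_left 1 n) (.mono (ensures_forTo (c := 1) (N := i)
    (fun k s' => s'.reg Reg.key = if v i ∈ (range k).image v then (n + 1) ^ classIdx v i
      else (n + 1) ^ #((range i).image v)) le_rfl rfl rfl (by decide) hsi hwidth ?_)
    (by omega) ?_))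
  · intro k hk s₁ hs₁ hk₁ hkey
    have hn₁ : s₁.reg Reg.jobs = n := (hs₁.reg_eq rfl).trans hn
    have hi₁ : s₁.reg Reg.i = i := (hs₁.reg_eq rfl).trans hsi
    have hmem₁ : s₁.mem = s.mem := hs₁.mem_eq rfl
    refine .exec rfl le_rfl ?_
    simp only [Prog.exec, Expr.eval, eval_jobField, eval_sortedCell, hn₁, hi₁, hk₁, hmem₁,
      (hv i hi).2, (hv k (hk.trans hi)).2, hkeys k hk, range_add_one, image_insert, mem_insert]
    rcases lt_trichotomy (v k) (v i) with h | h | h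
    · simp only [h, h.ne', false_or, if_true]
      exact hkey
    · simp only [h, lt_irrefl, if_false, classIdx_congr h, true_or, if_true]
      rfl
    · simp only [h, h.ne, h.asymm, false_or, if_true, if_false]
      exact hkey
  · intro s₁ _ hkey
    rw [hkey]
    split_ifs with h
    · rfl
    · rw [classIdx_of_notMem h]

/-- Multiply the contents of register `width` by the number of jobs plus one. -/
def scaleWidth : Prog :=
  .set Reg.sum (.const 0) ;;
  forTo Reg.k Reg.jobs (.set Reg.sum (.add (.reg Reg.sum) (.reg Reg.width))) ;;
  .set Reg.width (.add (.reg Reg.sum) (.reg Reg.width))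

theorem ensures_scaleWidth {n : ℕ} {s : State} (hn : s.reg Reg.jobs = n) :
    Ensures scaleWidth (n + 1) (fun s' => s'.reg Reg.width = s.reg Reg.width * (n + 1)) s := by
  refine .seq (.exec rfl (Nat.le_add_left 1 n) (.seq (.mono (ensures_forTo (N := n)
    (fun k s' => s'.reg Reg.sum = s.reg Reg.width * k) le_rfl rfl rfl (by decide) hn rfl ?_)
    (Nat.one_mul _).le ?_)))
  · intro k _ s₁ hs₁ _ hsum
    have hwidth : s₁.reg Reg.width = s.reg Reg.width := hs₁.reg_eq rfl
    refine .exec rfl le_rfl ?_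
    change s₁.reg Reg.sum + s₁.reg Reg.width = _
    rw [hsum, hwidth, Nat.mul_add_one]
  · intro s₁ hs₁ hsum
    have hwidth : s₁.reg Reg.width = s.reg Reg.width := hs₁.reg_eq rfl
    refine .exec rfl (Nat.le_add_left 1 n) ?_
    change s₁.reg Reg.sum + s₁.reg Reg.width = _
    rw [hsum, hwidth, Nat.mul_add_one]

/-- Store the keys of the jobs with respect to the values in field `f`. The width of the table, in
register `width`, is the least power of the number of jobs plus one that is not yet a key. -/
def makeKeys (f : ℕ) : Prog :=
  .set Reg.width (.const 1) ;;
  forTo Reg.i Reg.jobs (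
    findKey f ;;
    .store (sortedCell Reg.i 2) (.reg Reg.key) ;;
    .cond (.reg Reg.key) (.reg Reg.width) .skip scaleWidth)

theorem ensures_updateWidth {v : ℕ → ℕ} {n i : ℕ} {s : State} (hn : s.reg Reg.jobs = n)
    (hi : i < n) (hkey : s.reg Reg.key = (n + 1) ^ classIdx v i)
    (hwidth : s.reg Reg.width = (n + 1) ^ #((range i).image v)) :
    Ensures (.cond (.reg Reg.key) (.reg Reg.width) .skip scaleWidth) (n + 1)
      (fun s' => s'.mem = s.mem ∧ s'.reg Reg.width = (n + 1) ^ #((range (i + 1)).image v)) s := by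
  have hlt_iff : s.reg Reg.key < s.reg Reg.width ↔ v i ∈ (range i).image v := by
    rw [hkey, hwidth, Nat.pow_lt_pow_iff_right (by omega)]
    refine ⟨fun h => by_contra fun h' => h.ne (classIdx_of_notMem h'), fun h => ?_⟩
    obtain ⟨q, hq, hqi⟩ := mem_image.1 h
    exact classIdx_congr hqi ▸ classIdx_lt (mem_range.1 hq)
  rw [range_add_one, image_insert]
  refine .cond (Nat.le_add_left 1 n) (fun h => .exec rfl (Nat.le_add_left 1 n) ⟨rfl, ?_⟩)
    fun h => (ensures_scaleWidth hn).mono le_rfl fun s' hs' h' => ⟨hs'.mem_eq rfl, ?_⟩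
  · rw [insert_eq_of_mem (hlt_iff.1 h)]
    exact hwidth
  · rw [h', hwidth, card_insert_of_notMem (mt hlt_iff.2 h), Nat.pow_succ]

theorem ensures_makeKeys {v : ℕ → ℕ} {n f : ℕ} {s : State} (hn : s.reg Reg.jobs = n) (hf : f ≤ 3)
    (hv : Stored v n f s.mem) :
    Ensures (makeKeys f) ((n + 1) * (n + 1)) (fun s' =>
      (∀ q < n, s'.mem (3 * (n + q) + 2) = (n + 1) ^ classIdx v q) ∧
      s'.reg Reg.width = (n + 1) ^ #((range n).image v) ∧
      ∀ a, (∀ q < n, a ≠ 3 * (n + q) + 2) → s'.mem a = s.mem a) s := by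
  have hc : 1 ≤ n + 1 := Nat.le_add_left 1 n
  refine .seq (.exec rfl (Nat.le_mul_of_pos_left _ hc |>.trans' hc) (ensures_forTo (fun k s' =>
    (∀ q < k, s'.mem (3 * (n + q) + 2) = (n + 1) ^ classIdx v q) ∧
    s'.reg Reg.width = (n + 1) ^ #((range k).image v) ∧
    ∀ a, (∀ q < n, a ≠ 3 * (n + q) + 2) → s'.mem a = s.mem a) hc rfl rfl (by decide) hn
    ⟨fun q hq => absurd hq q.not_lt_zero, rfl, fun a _ => rfl⟩ ?_))
  rintro i hi s₁ hs₁ hi₁ ⟨hkeys, hwidth, hmem⟩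
  have hn₁ : s₁.reg Reg.jobs = n := (hs₁.reg_eq rfl).trans hn
  have hv₁ : Stored v n f s₁.mem :=
    hv.congr hf fun a _ ha => hmem a fun q _ => by omega
  refine .seq ((ensures_findKey hn₁ hi₁ hi hv₁ hkeys hwidth).mono le_rfl fun s₂ hs₂ hkey => ?_)
  have hn₂ : s₂.reg Reg.jobs = n := (hs₂.reg_eq rfl).trans hn₁
  have hi₂ : s₂.reg Reg.i = i := (hs₂.reg_eq rfl).trans hi₁
  have hmem₂ : s₂.mem = s₁.mem := hs₂.mem_eq rfl
  refine .seq (.exec rfl hc (.mono (ensures_updateWidth hn₂ hi hkey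
    ((hs₂.reg_eq rfl).trans hwidth)) le_rfl fun s₃ _ h₃ => ?_))
  simp only [Prog.exec, Expr.eval, eval_sortedCell, hn₂, hi₂, hkey, hmem₂] at h₃
  obtain ⟨hmem₃, hwidth₃⟩ := h₃
  refine ⟨fun q hq => ?_, hwidth₃, fun a ha => ?_⟩
  · rcases Nat.lt_succ_iff_lt_or_eq.1 hq with hq | rfl
    · rw [hmem₃, update_of_ne (by omega), hkeys q hq]
    · rw [hmem₃, update_self]
  · rw [hmem₃, update_of_ne (ha i hi), hmem a ha]

/-! ### Filling the table -/

/-- The table entry in record `e` of the memory. -/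
def entryAt (m : ℕ → ℕ) (e : ℕ) : Entry := ⟨m (3 * e + 1), m (3 * e + 2), m (3 * e + 3)⟩

/-- The table entry in the registers `tag`, `time`, `weight`. -/
def State.regEntry (s : State) : Entry := ⟨s.reg Reg.tag, s.reg Reg.time, s.reg Reg.weight⟩

/-- The registers and the first records hold the input of the dynamic program: the number `n` of
jobs, the width `N` of the table, the jobs `J` and their keys `κ`. -/
structure Loaded (J : Jobs) (κ : ℕ → ℕ) (n N : ℕ) (s : State) : Prop where
  jobs : s.reg Reg.jobs = n
  width : s.reg Reg.width = N
  p : Stored J.p n 1 s.mem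
  d : Stored J.d n 2 s.mem
  w : Stored J.w n 3 s.mem
  key : ∀ q < n, s.mem (3 * (n + q) + 2) = κ q

theorem Loaded.congr {J : Jobs} {κ : ℕ → ℕ} {n N : ℕ} {s s' : State} (h : Loaded J κ n N s)
    (hjobs : s'.reg Reg.jobs = s.reg Reg.jobs) (hwidth : s'.reg Reg.width = s.reg Reg.width)
    (hmem : ∀ a ≤ 6 * n, a ≤ 3 * n ∨ a % 3 ≠ 0 → s'.mem a = s.mem a) : Loaded J κ n N s' where
  jobs := hjobs.trans h.jobs
  width := hwidth.trans h.width
  p := h.p.congr (by decide) fun a ha _ => hmem a ha (by omega)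
  d := h.d.congr (by decide) fun a ha _ => hmem a ha (by omega)
  w := h.w.congr (by decide) fun a ha _ => hmem a ha (by omega)
  key q hq := (hmem _ (by omega) (by omega)).trans (h.key q hq)

/-- Load the entry that results from leaving out the job `row`. -/
def leaveJob : Prog :=
  .set Reg.tag (.load (cell (.reg Reg.ptr) 1)) ;;
  .set Reg.tag (.sub (.reg Reg.tag) (.sub (.reg Reg.tag) (.const 1))) ;;
  .set Reg.time (.load (cell (.reg Reg.ptr) 2)) ;;
  .set Reg.weight (.load (cell (.reg Reg.ptr) 3))

/-- Replace the entry in the registers by the one that results from adding the job `row` to the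
record `cand`, if this is admissible and better. -/
def addJob : Prog :=
  let replace : Prog :=
    .set Reg.tag (.const 2) ;;
    .set Reg.time (.reg Reg.sum) ;;
    .set Reg.weight (.add (.load (cell (.reg Reg.cand) 3)) (jobField Reg.row 3))
  .cond (.const 0) (.load (cell (.reg Reg.cand) 1)) (
    .set Reg.sum (.add (.load (cell (.reg Reg.cand) 2)) (jobField Reg.row 1)) ;;
    .cond (jobField Reg.row 2) (.reg Reg.sum) .skip (
      .cond (.const 0) (.reg Reg.tag) (
        .cond (.add (.reg Reg.sum) (.reg Reg.weight))
          (.add (.reg Reg.time) (.add (.load (cell (.reg Reg.cand) 3)) (jobField Reg.row 3)))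
          replace .skip)
        replace))
    .skip

/-- Compute the table entry for column `col` of the row after row `row`. -/
def stepEntry : Prog :=
  leaveJob ;;
  .cond (.reg Reg.col) (.load (sortedCell Reg.row 2)) .skip (
    .set Reg.cand (.sub (.reg Reg.ptr) (.load (sortedCell Reg.row 2))) ;;
    addJob)

theorem ensures_leaveJob (s : State) :
    Ensures leaveJob 1 (fun s' => s'.regEntry = ⟨min (entryAt s.mem (s.reg Reg.ptr)).tag 1,
      (entryAt s.mem (s.reg Reg.ptr)).time, (entryAt s.mem (s.reg Reg.ptr)).weight⟩) s := by
  refine .exec rfl le_rfl ?_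
  have hmin (t : ℕ) : t - (t - 1) = min t 1 := by omega
  simp [leaveJob, Prog.exec, Expr.eval, eval_cell, State.regEntry, entryAt, hmin]

theorem regEntry_exec_addJob {J : Jobs} {κ : ℕ → ℕ} {n N r : ℕ} {s : State}
    (hs : Loaded J κ n N s) (hrow : s.reg Reg.row = r) (hr : r < n) {o : Entry}
    (ho : s.regEntry = ⟨min o.tag 1, o.time, o.weight⟩) :
    (addJob.exec s).regEntry =
      .step (J.p r) (J.d r) (J.w r) o (entryAt s.mem (s.reg Reg.cand)) := by
  obtain ⟨htag, htime, hweight⟩ := Entry.mk.inj ho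
  simp +decide only [addJob, Prog.exec, Expr.eval, eval_cell, eval_jobField, update_self,
    update_of_ne, ne_eq, hs.jobs, hrow, (hs.p r hr).2, (hs.d r hr).2,
    (hs.w r hr).2, htag, htime, hweight, apply_ite State.regEntry]
  simp +decide only [State.regEntry, update_self, update_of_ne, ne_eq, htag, htime, hweight,
    entryAt, Entry.step]
  split_ifs <;> first | (simp_all; done) | (exfalso; omega)

theorem ensures_stepEntry {J : Jobs} {κ : ℕ → ℕ} {n N r x : ℕ} {s : State}
    (hs : Loaded J κ n N s) (hrow : s.reg Reg.row = r) (hr : r < n) (hcol : s.reg Reg.col = x) :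
    Ensures stepEntry 1 (fun s' => s'.regEntry =
      .step (J.p r) (J.d r) (J.w r) (entryAt s.mem (s.reg Reg.ptr))
        (if κ r ≤ x then entryAt s.mem (s.reg Reg.ptr - κ r) else .none)) s := by
  refine .seq ((ensures_leaveJob s).mono le_rfl fun s₁ hs₁ ho =>
    .exec rfl le_rfl ?_)
  have hload₁ : Loaded J κ n N s₁ :=
    hs.congr (hs₁.reg_eq rfl) (hs₁.reg_eq rfl) fun a _ _ => congrFun (hs₁.mem_eq rfl) a
  have hrow₁ : s₁.reg Reg.row = r := (hs₁.reg_eq rfl).trans hrow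
  have hcol₁ : s₁.reg Reg.col = x := (hs₁.reg_eq rfl).trans hcol
  have hptr₁ : s₁.reg Reg.ptr = s.reg Reg.ptr := hs₁.reg_eq rfl
  rw [← hs₁.mem_eq rfl, ← hptr₁] at ho ⊢
  simp only [Prog.exec, Expr.eval, eval_sortedCell, hload₁.jobs, hrow₁, hcol₁, hload₁.key r hr]
  split_ifs with hlt hle hle
  · exact absurd hle (not_le.2 hlt)
  · rw [ho, Entry.step, if_neg fun h => lt_irrefl _ h.1]
  · exact regEntry_exec_addJob (s := ⟨update s₁.reg Reg.cand (s₁.reg Reg.ptr - κ r), s₁.mem⟩)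
      (hload₁.congr rfl rfl fun _ _ _ => rfl) hrow₁ hr ho
  · exact absurd (not_lt.1 hlt) hle

/-- Store the entry in the registers one row below the record `ptr`. -/
def storeEntry : Prog :=
  .store (cell (.add (.reg Reg.ptr) (.reg Reg.width)) 1) (.reg Reg.tag) ;;
  .store (cell (.add (.reg Reg.ptr) (.reg Reg.width)) 2) (.reg Reg.time) ;;
  .store (cell (.add (.reg Reg.ptr) (.reg Reg.width)) 3) (.reg Reg.weight)

theorem entryAt_exec_storeEntry (s : State) :
    entryAt (storeEntry.exec s).mem (s.reg Reg.ptr + s.reg Reg.width) = s.regEntry := by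
  simp [storeEntry, Prog.exec, Expr.eval, eval_cell, entryAt, State.regEntry]

theorem mem_exec_storeEntry {s : State} {a : ℕ}
    (ha : a ≤ 3 * (s.reg Reg.ptr + s.reg Reg.width) ∨
      3 * (s.reg Reg.ptr + s.reg Reg.width) + 3 < a) :
    (storeEntry.exec s).mem a = s.mem a := by
  simp only [storeEntry, Prog.exec, Expr.eval, eval_cell]
  rw [update_of_ne (by omega), update_of_ne (by omega), update_of_ne (by omega)]

theorem entryAt_exec_storeEntry_of_ne {s : State} {e : ℕ}
    (he : e ≠ s.reg Reg.ptr + s.reg Reg.width) :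
    entryAt (storeEntry.exec s).mem e = entryAt s.mem e := by
  rw [entryAt, mem_exec_storeEntry (by omega), mem_exec_storeEntry (by omega),
    mem_exec_storeEntry (by omega), entryAt]

/-- The first `M` entries of the table, in the row-major order, are in the memory. -/
def Filled (J : Jobs) (κ : ℕ → ℕ) (n N M : ℕ) (m : ℕ → ℕ) : Prop :=
  ∀ y < M, entryAt m (2 * n + y) = J.table κ (y / N) (y % N)

theorem Filled.entryAt_eq {J : Jobs} {κ m : ℕ → ℕ} {n N M r x : ℕ} (h : Filled J κ n N M m)
    (hx : x < N) (hM : N * r + x < M) : entryAt m (2 * n + (N * r + x)) = J.table κ r x := by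
  rw [h _ hM, Nat.mul_add_div (by omega), Nat.mul_add_mod, Nat.div_eq_of_lt hx, Nat.mod_eq_of_lt hx,
    Nat.add_zero]

theorem Filled.succ {J : Jobs} {κ m m' : ℕ → ℕ} {n N r x : ℕ} (h : Filled J κ n N (N * r + x) m)
    (hx : x < N) (hm : ∀ e < 2 * n + (N * r + x), entryAt m' e = entryAt m e)
    (hm' : entryAt m' (2 * n + (N * r + x)) = J.table κ r x) :
    Filled J κ n N (N * r + x + 1) m' := by
  intro y hy
  rcases Nat.lt_succ_iff_lt_or_eq.1 hy with hy | rfl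
  · rw [hm _ (by omega), h y hy]
  · rw [hm', Nat.mul_add_div (by omega), Nat.mul_add_mod, Nat.div_eq_of_lt hx, Nat.mod_eq_of_lt hx,
      Nat.add_zero]

/-- Compute and store one entry of the table, and move `ptr` to the next column. -/
def fillEntry : Prog := stepEntry ;; storeEntry ;; inc Reg.ptr

theorem ensures_fillEntry {J : Jobs} {κ : ℕ → ℕ} {n N r x : ℕ} {s : State}
    (hs : Loaded J κ n N s) (hrow : s.reg Reg.row = r) (hr : r < n) (hcol : s.reg Reg.col = x)
    (hx : x < N) (hptr : s.reg Reg.ptr = 2 * n + (N * r + x))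
    (hfill : Filled J κ n N (N * (r + 1) + x) s.mem) :
    Ensures fillEntry 1 (fun s' => s'.reg Reg.ptr = 2 * n + (N * r + (x + 1)) ∧
      Filled J κ n N (N * (r + 1) + (x + 1)) s'.mem ∧ ∀ a ≤ 6 * n, s'.mem a = s.mem a) s := by
  refine .seq ((ensures_stepEntry hs hrow hr hcol).mono le_rfl fun s₁ hs₁ hstep =>
    .seq (.exec rfl le_rfl (.exec rfl le_rfl ?_)))
  have hmem₁ : s₁.mem = s.mem := hs₁.mem_eq rfl
  have hptr₁ : s₁.reg Reg.ptr = 2 * n + (N * r + x) := (hs₁.reg_eq rfl).trans hptr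
  have hwidth₁ : s₁.reg Reg.width = N := (hs₁.reg_eq rfl).trans hs.width
  have hrow_lt : N * r + x < N * (r + 1) + x := by rw [Nat.mul_add_one]; omega
  have hnext : s₁.reg Reg.ptr + s₁.reg Reg.width = 2 * n + (N * (r + 1) + x) := by
    rw [hptr₁, hwidth₁, Nat.mul_add_one]
    omega
  refine ⟨congrArg (· + 1) hptr₁, hfill.succ hx (fun e he => ?_) ?_, fun a ha => ?_⟩
  · exact (entryAt_exec_storeEntry_of_ne (by omega)).trans (by rw [hmem₁])
  · refine (congrArg _ hnext.symm).trans ((entryAt_exec_storeEntry s₁).trans ?_)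
    rw [hstep, hptr, hfill.entryAt_eq hx hrow_lt, Jobs.table]
    split_ifs with hκ
    · rw [Nat.add_sub_assoc (by omega), Nat.add_sub_assoc hκ,
        hfill.entryAt_eq ((Nat.sub_le _ _).trans_lt hx) (by omega)]
    · rfl
  · exact (mem_exec_storeEntry (by omega)).trans (by rw [hmem₁])

/-- Fill the row after row `row` of the table. -/
def fillRow : Prog := forTo Reg.col Reg.width fillEntry

theorem ensures_fillRow {J : Jobs} {κ : ℕ → ℕ} {n N r : ℕ} {s : State}
    (hs : Loaded J κ n N s) (hrow : s.reg Reg.row = r) (hr : r < n)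
    (hptr : s.reg Reg.ptr = 2 * n + N * r) (hfill : Filled J κ n N (N * (r + 1)) s.mem) :
    Ensures fillRow (N + 1) (fun s' => s'.reg Reg.ptr = 2 * n + N * (r + 1) ∧
      Filled J κ n N (N * (r + 2)) s'.mem ∧ ∀ a ≤ 6 * n, s'.mem a = s.mem a) s := by
  refine .mono (ensures_forTo (c := 1) (fun x s' => s'.reg Reg.ptr = 2 * n + (N * r + x) ∧
      Filled J κ n N (N * (r + 1) + x) s'.mem ∧ ∀ a ≤ 6 * n, s'.mem a = s.mem a) le_rfl rfl rfl
      (by decide) hs.width ⟨hptr, hfill, fun a _ => rfl⟩ ?_)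
    (Nat.one_mul _).le fun s' _ h => h
  rintro x hx s₁ hs₁ hcol₁ ⟨hptr₁, hfill₁, hmem₁⟩
  have hload₁ : Loaded J κ n N s₁ :=
      hs.congr (hs₁.reg_eq rfl) (hs₁.reg_eq rfl) fun a ha _ => hmem₁ a ha
  refine (ensures_fillEntry hload₁ ((hs₁.reg_eq rfl).trans hrow) hr hcol₁ hx hptr₁ hfill₁).mono
    le_rfl fun s₂ _ ⟨hptr₂, hfill₂, hmem₂⟩ => ⟨hptr₂, hfill₂, fun a ha => ?_⟩
  exact (hmem₂ a ha).trans (hmem₁ a ha)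

/-- Fill the table, given that its cells are `0`. In the end `ptr` points to the last row. -/
def fillTable : Prog :=
  .set Reg.ptr (.add (.reg Reg.jobs) (.reg Reg.jobs)) ;;
  .store (cell (.reg Reg.ptr) 1) (.const 1) ;;
  forTo Reg.row Reg.jobs fillRow

theorem ensures_fillTable {J : Jobs} {κ : ℕ → ℕ} {n N : ℕ} {s : State} (hs : Loaded J κ n N s)
    (hzero : ∀ a, 6 * n < a → s.mem a = 0) :
    Ensures fillTable ((N + 1) * (n + 1)) (fun s' => s'.reg Reg.ptr = 2 * n + N * n ∧
      Filled J κ n N (N * (n + 1)) s'.mem ∧ ∀ a ≤ 6 * n, s'.mem a = s.mem a) s := by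
  have hc : 1 ≤ (N + 1) * (n + 1) := Nat.mul_pos N.succ_pos n.succ_pos
  refine .seq (.exec rfl hc (.seq (.exec rfl hc (ensures_forTo (fun r s' =>
    s'.reg Reg.ptr = 2 * n + N * r ∧ Filled J κ n N (N * (r + 1)) s'.mem ∧
      ∀ a ≤ 6 * n, s'.mem a = s.mem a) (Nat.le_add_left 1 N) rfl rfl (by decide) hs.jobs ?_ ?_))))
  · have hptr : n + n = 2 * n := (Nat.two_mul n).symm
    simp +decide only [Prog.exec, Expr.eval, eval_cell, hs.jobs, update_self, hptr]
    refine ⟨rfl, fun y hy => ?_, fun a ha => update_of_ne (by omega) _ _⟩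
    rw [Nat.mul_one] at hy
    rw [entryAt, Nat.div_eq_of_lt hy, Nat.mod_eq_of_lt hy, Jobs.table]
    rcases Nat.eq_zero_or_pos y with rfl | hpos
    · rw [if_pos rfl, Nat.add_zero (2 * n), update_self, update_of_ne (by omega),
        update_of_ne (by omega), hzero _ (by omega), hzero _ (by omega)]
    · rw [if_neg hpos.ne', update_of_ne (by omega), update_of_ne (by omega),
        update_of_ne (by omega), hzero _ (by omega), hzero _ (by omega), hzero _ (by omega)]
      rfl
  · rintro r hr s₁ hs₁ hrow₁ ⟨hptr₁, hfill₁, hmem₁⟩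
    have hload₁ : Loaded J κ n N s₁ :=
      hs.congr (hs₁.reg_eq rfl) (hs₁.reg_eq rfl) fun a ha _ => hmem₁ a ha
    refine (ensures_fillRow hload₁ hrow₁ hr hptr₁ hfill₁).mono le_rfl
      fun s₂ _ ⟨hptr₂, hfill₂, hmem₂⟩ => ⟨hptr₂, hfill₂, fun a ha => ?_⟩
    exact (hmem₂ a ha).trans (hmem₁ a ha)

/-! ### Reading off an optimal set -/

/-- Advance `ptr` from the beginning of a row to an entry of maximum weight. -/
def findBest : Prog :=
  .set Reg.best (.const 0) ;;
  forTo Reg.col Reg.width (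
    .cond (.load (cell (.add (.reg Reg.ptr) (.reg Reg.best)) 3))
      (.load (cell (.add (.reg Reg.ptr) (.reg Reg.col)) 3))
      (.set Reg.best (.reg Reg.col)) .skip) ;;
  .set Reg.ptr (.add (.reg Reg.ptr) (.reg Reg.best))

theorem ensures_findBest {N e : ℕ} {s : State} (hwidth : s.reg Reg.width = N)
    (hptr : s.reg Reg.ptr = e) (hN : 0 < N) :
    Ensures findBest (N + 1) (fun s' => ∃ b < N, s'.reg Reg.ptr = e + b ∧
      ∀ x < N, (entryAt s.mem (e + x)).weight ≤ (entryAt s.mem (e + b)).weight) s := by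
  have hc : 1 ≤ N + 1 := Nat.le_add_left 1 N
  refine .seq (.exec rfl hc (.seq (.mono (ensures_forTo (c := 1) (fun k s' => s'.reg Reg.best < N ∧
    ∀ x < k, (entryAt s.mem (e + x)).weight ≤ (entryAt s.mem (e + s'.reg Reg.best)).weight)
    le_rfl rfl rfl (by decide) hwidth ⟨hN, fun x hx => absurd hx x.not_lt_zero⟩ ?_)
    (Nat.one_mul _).le ?_)))
  · rintro x hx s₁ hs₁ hcol₁ ⟨hlt, hbest⟩
    have hptr₁ : s₁.reg Reg.ptr = e := (hs₁.reg_eq rfl).trans hptr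
    have hmem₁ : s₁.mem = s.mem := hs₁.mem_eq rfl
    have hweight (y) : s.mem (3 * (e + y) + 3) = (entryAt s.mem (e + y)).weight := rfl
    refine .exec rfl le_rfl ?_
    simp only [Prog.exec, Expr.eval, eval_cell, hptr₁, hcol₁, hmem₁, hweight]
    split_ifs with h
    · exact ⟨hx, Nat.forall_lt_succ_right.2 ⟨fun y hy => (hbest y hy).trans h.le, le_rfl⟩⟩
    · exact ⟨hlt, Nat.forall_lt_succ_right.2 ⟨hbest, not_lt.1 h⟩⟩
  · rintro s₁ hs₁ ⟨hlt, hbest⟩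
    exact .exec rfl hc ⟨_, hlt, congrArg (· + _) ((hs₁.reg_eq rfl).trans hptr), hbest⟩

namespace Jobs

variable {J : Jobs} {κ : ℕ → ℕ} {r x : ℕ}

theorem self_mem_trace_succ : r ∈ J.trace κ (r + 1) x ↔ 1 < (J.table κ (r + 1) x).tag := by
  rw [trace]
  split_ifs with h
  · exact iff_of_true (mem_insert_self ..) h
  · exact iff_of_false (notMem_trace _ _) h

theorem key_le_of_mem_trace (h : r ∈ J.trace κ (r + 1) x) : κ r ≤ x := by
  obtain ⟨hx, -⟩ | ⟨htrace, -⟩ := J.table_succ_cases κ r x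
  · exact hx
  · exact absurd (htrace ▸ h) (notMem_trace _ _)

theorem mem_trace_succ_of_lt {q : ℕ} (hq : q < r) : q ∈ J.trace κ (r + 1) x ↔
    q ∈ J.trace κ r (if r ∈ J.trace κ (r + 1) x then x - κ r else x) := by
  simp only [self_mem_trace_succ]
  rw [trace]
  split_ifs
  · rw [mem_insert, or_iff_right hq.ne]
  · rfl

end Jobs

/-- Store in the output flag of the job `row` whether it is missing in the set recorded in the entry
`ptr` of the next row, and move `ptr` to the entry that this one was computed from. -/
def backtrackJob : Prog :=
  .cond (.const 1) (.load (cell (.reg Reg.ptr) 1)) (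
      .store (sortedCell Reg.row 3) (.const 0) ;;
      .set Reg.ptr (.sub (.reg Reg.ptr) (.load (sortedCell Reg.row 2))))
    (.store (sortedCell Reg.row 3) (.const 1)) ;;
  .set Reg.ptr (.sub (.reg Reg.ptr) (.reg Reg.width))

theorem ensures_backtrackJob {J : Jobs} {κ : ℕ → ℕ} {n N r x : ℕ} {s : State}
    (hs : Loaded J κ n N s) (hrow : s.reg Reg.row = r) (hr : r < n)
    (hptr : s.reg Reg.ptr = 2 * n + (N * (r + 1) + x))
    (hentry : entryAt s.mem (2 * n + (N * (r + 1) + x)) = J.table κ (r + 1) x) :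
    Ensures backtrackJob 1 (fun s' =>
      s'.reg Reg.ptr = 2 * n + (N * r + if r ∈ J.trace κ (r + 1) x then x - κ r else x) ∧
      s'.mem = update s.mem (3 * (n + r) + 3) (if r ∈ J.trace κ (r + 1) x then 0 else 1)) s := by
  refine .exec rfl le_rfl ?_
  have htag : s.mem (3 * (2 * n + (N * (r + 1) + x)) + 1) = (J.table κ (r + 1) x).tag :=
    congrArg Entry.tag hentry
  have hmul : N * (r + 1) = N * r + N := Nat.mul_add_one N r
  simp +decide only [backtrackJob, Prog.exec, Expr.eval, eval_cell, eval_sortedCell, hptr, hrow,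
    hs.jobs, htag, ← Jobs.self_mem_trace_succ]
  split_ifs with h
  · have hκ : κ r ≤ x := Jobs.key_le_of_mem_trace h
    simp +decide only [update_self, update_of_ne, ne_eq, hs.width]
    rw [update_of_ne (by omega), hs.key r hr]
    exact ⟨by omega, trivial⟩
  · simp +decide only [update_self, hs.width, hptr]
    exact ⟨by omega, trivial⟩

/-- Store the output flags of all jobs, by following the table back from the entry `ptr` in its last
row. -/
def backtrack : Prog :=
  .set Reg.row (.reg Reg.jobs) ;;
  forTo Reg.k Reg.jobs (.set Reg.row (.sub (.reg Reg.row) (.const 1)) ;; backtrackJob)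

/-- The state of `backtrack`, started with the memory `m`, when the jobs before `r` are left and the
recorded set is `T`. -/
structure Backtracked (J : Jobs) (κ : ℕ → ℕ) (n N : ℕ) (m : ℕ → ℕ) (T : Finset ℕ) (r : ℕ)
    (s : State) : Prop where
  loaded : Loaded J κ n N s
  row : s.reg Reg.row = r
  ptr : ∃ x < N, s.reg Reg.ptr = 2 * n + (N * r + x) ∧ ∀ q < r, q ∈ T ↔ q ∈ J.trace κ r x
  flag : ∀ q < n, r ≤ q → s.mem (3 * (n + q) + 3) = if q ∈ T then 0 else 1
  mem : ∀ a, (∀ q < n, a ≠ 3 * (n + q) + 3) → s.mem a = m a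

theorem Backtracked.ensures_pred {J : Jobs} {κ m : ℕ → ℕ} {n N r : ℕ} {T : Finset ℕ}
    {s : State} (hs : Backtracked J κ n N m T (r + 1) s) (hr : r < n)
    (hfill : Filled J κ n N (N * (n + 1)) m) :
    Ensures backtrackJob 1 (Backtracked J κ n N m T r) ⟨update s.reg Reg.row r, s.mem⟩ := by
  obtain ⟨x, hx, hptr, hT⟩ := hs.ptr
  have hload := hs.loaded.congr (s' := ⟨update s.reg Reg.row r, s.mem⟩) rfl rfl fun _ _ _ => rfl
  have hentry : entryAt s.mem (2 * n + (N * (r + 1) + x)) = J.table κ (r + 1) x := by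
    rw [entryAt, hs.mem _ (by omega), hs.mem _ (by omega), hs.mem _ (by omega)]
    exact hfill.entryAt_eq hx (by nlinarith)
  have hTr : r ∈ T ↔ r ∈ J.trace κ (r + 1) x := hT r r.lt_succ_self
  refine (ensures_backtrackJob (r := r) hload rfl hr hptr hentry).mono le_rfl
    fun s' hs' ⟨hptr', hmem'⟩ => ?_
  refine ⟨hload.congr (hs'.reg_eq rfl) (hs'.reg_eq rfl) fun a _ ha => ?_, hs'.reg_eq rfl,
    ⟨_, ?_, hptr', fun q hq => ?_⟩, fun q hq hrq => ?_, fun a ha => ?_⟩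
  · rw [hmem', update_of_ne (by omega)]
  · split_ifs <;> omega
  · rw [hT q (by omega), Jobs.mem_trace_succ_of_lt hq]
  · rw [hmem']
    rcases hrq.eq_or_lt with rfl | hrq
    · simp only [update_self, hTr]
    · rw [update_of_ne (by omega), hs.flag q hq hrq]
  · rw [hmem', update_of_ne (ha r hr), hs.mem a ha]

theorem ensures_backtrack {J : Jobs} {κ : ℕ → ℕ} {n N b : ℕ} {s : State}
    (hs : Loaded J κ n N s) (hfill : Filled J κ n N (N * (n + 1)) s.mem) (hb : b < N)
    (hptr : s.reg Reg.ptr = 2 * n + (N * n + b)) :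
    Ensures backtrack (n + 1) (fun s' =>
      (∀ q < n, s'.mem (3 * (n + q) + 3) = if q ∈ J.trace κ n b then 0 else 1) ∧
      ∀ a, (∀ q < n, a ≠ 3 * (n + q) + 3) → s'.mem a = s.mem a) s := by
  refine .seq (.exec rfl (Nat.le_add_left 1 n) (.mono (ensures_forTo (c := 1)
    (fun k => Backtracked J κ n N s.mem (J.trace κ n b) (n - k)) le_rfl rfl rfl (by decide) hs.jobs
    ⟨hs.congr rfl rfl fun _ _ _ => rfl, hs.jobs, ⟨b, hb, hptr, fun _ _ => .rfl⟩,
      fun q hq h => absurd hq (not_lt.2 h), fun _ _ => rfl⟩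
    ?_) (Nat.one_mul _).le fun s' _ h => ⟨fun q hq => h.flag q hq (by omega), h.mem⟩))
  intro k hk s₁ _ _ hback
  obtain ⟨r, hr⟩ : ∃ r, n - k = r + 1 := ⟨n - k - 1, by omega⟩
  rw [hr] at hback
  rw [show n - (k + 1) = r by omega]
  refine .seq (.exec rfl le_rfl ?_)
  simp only [Prog.exec, Expr.eval, hback.row, Nat.add_sub_cancel]
  exact (hback.ensures_pred (by omega) hfill).mono le_rfl fun s' _ h =>
    ⟨h.loaded.congr rfl rfl fun _ _ _ => rfl, h.row, h.ptr, h.flag, h.mem⟩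

/-! ### The complete program -/

section Input

variable {n : ℕ} {I : Instance n}

theorem initialState_mem_p (j : Fin n) : I.initialState.mem (3 * j + 1) = I.p j := by
  simp [Instance.initialState]

theorem initialState_mem_d (j : Fin n) : I.initialState.mem (3 * j + 2) = I.d j := by
  have hdiv : (3 * (j : ℕ) + 1) / 3 = j := by omega
  have hmod : (3 * (j : ℕ) + 1) % 3 = 1 := by omega
  simp [Instance.initialState, hdiv, hmod]

theorem initialState_mem_w (j : Fin n) : I.initialState.mem (3 * j + 3) = I.w j := by
  have hdiv : (3 * (j : ℕ) + 2) / 3 = j := by omega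
  have hmod : (3 * (j : ℕ) + 2) % 3 = 2 := by omega
  simp [Instance.initialState, hdiv, hmod]

theorem initialState_mem_eq_zero {a : ℕ} (ha : 3 * n < a) : I.initialState.mem a = 0 := by
  rw [Instance.initialState]
  dsimp only
  rw [if_neg (by omega), dif_neg (by omega)]

end Input

/-- Field `1` of the records of the positions in the order of the due dates holds the index of the
job. -/
def Indexed {n : ℕ} (I : Instance n) (m : ℕ → ℕ) : Prop :=
  ∀ j : Fin n, m (3 * (n + I.eddOrder j) + 1) = j

theorem Indexed.stored {n f : ℕ} {I : Instance n} {m v : ℕ → ℕ} {u : Fin n → ℕ}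
    (h : Indexed I m) (hv : ∀ j, v (I.eddOrder j) = u j)
    (hu : ∀ j : Fin n, m (3 * j + f) = u j) : Stored v n f m := by
  intro q hq
  obtain ⟨j, rfl⟩ := Instance.exists_eddOrder_eq (I := I) hq
  rw [h j, hv, hu]
  exact ⟨j.2, rfl⟩

/-- Sort the jobs by due dates. -/
def sort : Prog :=
  scatter (fun r => .load (cell (.reg r) 2)) (cell (.add (.reg Reg.jobs) (.reg Reg.rank)) 1)
    (.reg Reg.i)

theorem ensures_sort {n : ℕ} {I : Instance n} {s : State} (hn : s.reg Reg.jobs = n)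
    (hs : s.mem = I.initialState.mem) :
    Ensures sort ((n + 1) * (n + 1)) (fun s' => Indexed I s'.mem ∧
      ∀ a, (∀ q < n, a ≠ 3 * (n + q) + 1) → s'.mem a = s.mem a) s := by
  refine (ensures_scatter (α := fun r => 3 * (n + r) + 1) (v := extend Fin.val I.d 0) (u := id) hn
    (fun r _ r' _ h => ?_) (fun s' hn' hmem r hr => ?_) (fun s' hn' => ?_)
    fun s' _ _ _ => rfl).mono le_rfl fun s' _ ⟨hidx, hmem⟩ => ⟨fun j => hidx j j.2, hmem⟩
  · dsimp only at h
    omega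
  · rw [Expr.eval, eval_cell, Expr.eval, hmem _ fun q _ => by omega, hs]
    exact (initialState_mem_d ⟨_, hr⟩).trans (Fin.val_injective.extend_apply I.d 0 ⟨_, hr⟩).symm
  · rw [eval_cell, Expr.eval, Expr.eval, Expr.eval, hn']

/-- Write the schedule in which the jobs with output flag `0` come first. -/
def output : Prog :=
  scatter (fun r => .load (sortedCell r 3)) (.reg Reg.rank) (.load (sortedCell Reg.i 1))

theorem ensures_output {n : ℕ} {I : Instance n} {T : Finset ℕ} {s : State}
    (hn : s.reg Reg.jobs = n) (hidx : Indexed I s.mem)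
    (hflag : ∀ q < n, s.mem (3 * (n + q) + 3) = if q ∈ T then 0 else 1) :
    Ensures output ((n + 1) * (n + 1)) (fun s' => s'.Holds (I.schedule T)) s := by
  refine (ensures_scatter (α := id) (v := fun q => if q ∈ T then 0 else 1)
    (u := fun q => s.mem (3 * (n + q) + 1)) hn Function.injective_id.injOn
    (fun s' hn' hmem r hr => ?_) (fun s' _ => rfl) fun s' hn' hmem _ => ?_).mono le_rfl
    fun s' _ ⟨hsto, _⟩ i => ?_
  · rw [Expr.eval, eval_sortedCell, hn', hmem _ fun q hq => by dsimp only [id]; omega, hflag _ hr]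
  · rw [Expr.eval, eval_sortedCell, hn', hmem _ fun q hq => by dsimp only [id]; omega]
  · obtain ⟨j, rfl⟩ := (I.schedule T).surjective i
    rw [Equiv.symm_apply_apply, ← hidx j]
    exact hsto _ (I.eddOrder j).2

/-- Prepare the input of the dynamic program, with keys according to field `f` of the jobs. -/
def setup (f : ℕ) : Prog := .set Reg.jobs (.load (.const 0)) ;; sort ;; makeKeys f

theorem ensures_setup {n f : ℕ} {I : Instance n} {v : ℕ → ℕ}
    (hf : f = 1 ∧ v = I.eddJobs.p ∨ f = 3 ∧ v = I.eddJobs.w) :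
    Ensures (setup f) ((n + 1) * (n + 1)) (fun s =>
      Loaded I.eddJobs (fun q => (n + 1) ^ classIdx v q) n ((n + 1) ^ #((range n).image v)) s ∧
      Indexed I s.mem ∧ ∀ a, 6 * n < a → s.mem a = 0) I.initialState := by
  refine .seq (.exec rfl (Nat.mul_pos n.succ_pos n.succ_pos)
    (.seq (.mono (ensures_sort (I := I) ?_ rfl) le_rfl fun s₁ hs₁ ⟨hidx, hmem⟩ => ?_)))
  · rfl
  have hn₁ : s₁.reg Reg.jobs = n := hs₁.reg_eq rfl
  have hmem₁ (j : Fin n) {f} (hf : f ≤ 3) : s₁.mem (3 * j + f) = I.initialState.mem (3 * j + f) :=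
    hmem _ fun q _ => by omega
  have hp : Stored I.eddJobs.p n 1 s₁.mem :=
    hidx.stored I.eddJobs_p fun j => (hmem₁ j (by decide)).trans (initialState_mem_p j)
  have hd : Stored I.eddJobs.d n 2 s₁.mem :=
    hidx.stored I.eddJobs_d fun j => (hmem₁ j (by decide)).trans (initialState_mem_d j)
  have hw : Stored I.eddJobs.w n 3 s₁.mem :=
    hidx.stored I.eddJobs_w fun j => (hmem₁ j (by decide)).trans (initialState_mem_w j)
  have hv : f ≤ 3 ∧ Stored v n f s₁.mem := by
    rcases hf with ⟨rfl, rfl⟩ | ⟨rfl, rfl⟩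
    exacts [⟨by decide, hp⟩, ⟨le_rfl, hw⟩]
  refine (ensures_makeKeys hn₁ hv.1 hv.2).mono le_rfl fun s₂ hs₂ ⟨hkey, hwidth, hmem₂⟩ => ?_
  exact ⟨{
      jobs := (hs₂.reg_eq rfl).trans hn₁
      width := hwidth
      p := hp.congr (by decide) fun a _ ha => hmem₂ a fun q _ => by omega
      d := hd.congr (by decide) fun a _ ha => hmem₂ a fun q _ => by omega
      w := hw.congr le_rfl fun a _ ha => hmem₂ a fun q _ => by omega
      key := hkey },
    fun j => (hmem₂ _ fun q _ => by omega).trans (hidx j), fun a ha => by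
      rw [hmem₂ a fun q _ => by omega, hmem a fun q _ => by omega]
      exact initialState_mem_eq_zero (by omega)⟩

/-- The dynamic program on the sorted jobs: it marks a feasible set of jobs of maximal weight. -/
def dynamicProgram : Prog := fillTable ;; findBest ;; backtrack

theorem ensures_dynamicProgram {J : Jobs} {κ : ℕ → ℕ} {n N : ℕ} {s : State} (hs : Loaded J κ n N s)
    (hzero : ∀ a, 6 * n < a → s.mem a = 0) (hκ : KeyFor κ J.p n ∨ KeyFor κ J.w n)
    (hN : ∑ q ∈ range n, κ q < N) :
    Ensures dynamicProgram ((N + 1) * (n + 1)) (fun s' => ∃ T ⊆ range n, J.IsMaxFeasible n T ∧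
      (∀ q < n, s'.mem (3 * (n + q) + 3) = if q ∈ T then 0 else 1) ∧
      ∀ a ≤ 6 * n, a % 3 = 1 → s'.mem a = s.mem a) s := by
  refine .seq ((ensures_fillTable hs hzero).mono le_rfl fun s₁ hs₁ ⟨hptr₁, hfill, hmem₁⟩ => ?_)
  have hload₁ : Loaded J κ n N s₁ :=
    hs.congr (hs₁.reg_eq rfl) (hs₁.reg_eq rfl) fun a ha _ => hmem₁ a ha
  refine .seq ((ensures_findBest hload₁.width hptr₁ (by omega)).mono
    (Nat.le_mul_of_pos_right _ n.succ_pos) fun s₂ hs₂ ⟨b, hb, hptr₂, hbest⟩ => ?_)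
  have hmem₂ : s₂.mem = s₁.mem := hs₂.mem_eq rfl
  have hload₂ : Loaded J κ n N s₂ :=
    hload₁.congr (hs₂.reg_eq rfl) (hs₂.reg_eq rfl) fun a _ _ => congrFun hmem₂ a
  refine (ensures_backtrack hload₂ (hmem₂ ▸ hfill) hb (by omega)).mono
    (Nat.le_mul_of_pos_left _ N.succ_pos) fun s₃ _ ⟨hflag, hmem₃⟩ => ?_
  have htable {x : ℕ} (hx : x < N) : entryAt s₁.mem (2 * n + N * n + x) = J.table κ n x := by
    rw [Nat.add_assoc, hfill.entryAt_eq hx (by rw [Nat.mul_succ]; omega)]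
  refine ⟨_, Jobs.trace_subset n b, Jobs.isMaxFeasible_trace hκ hN fun x hx => ?_, hflag,
    fun a ha _ => ?_⟩
  · rw [← htable hx, ← htable hb]
    exact hbest x hx
  · rw [hmem₃ a fun q _ => by omega, hmem₂, hmem₁ a ha]

/-- The algorithm with keys according to field `f` of the jobs: `1` for processing times, `3` for
weights. -/
def solve (f : ℕ) : Prog := setup f ;; dynamicProgram ;; output

theorem ensures_solve {n f : ℕ} {I : Instance n} {v : ℕ → ℕ}
    (hf : f = 1 ∧ v = I.eddJobs.p ∨ f = 3 ∧ v = I.eddJobs.w) :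
    Ensures (solve f) ((n + 1) * (n + 1) + ((n + 1) ^ #((range n).image v) + 1) * (n + 1))
      (fun s => ∃ π, s.Holds π ∧ I.IsOptimal π) I.initialState := by
  have hκ : KeyFor (fun q => (n + 1) ^ classIdx v q) I.eddJobs.p n ∨
      KeyFor (fun q => (n + 1) ^ classIdx v q) I.eddJobs.w n := by
    rcases hf with ⟨-, rfl⟩ | ⟨-, rfl⟩
    exacts [.inl (keyFor_pow_classIdx _ n), .inr (keyFor_pow_classIdx _ n)]
  refine .seq ((ensures_setup hf).mono (Nat.le_add_right _ _) fun s₁ _ ⟨hload, hidx, hzero⟩ => ?_)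
  refine .seq ((ensures_dynamicProgram hload hzero hκ (sum_pow_classIdx_lt v n)).mono
    (Nat.le_add_left _ _) fun s₂ hs₂ ⟨T, hT, hmax, hflag, hmem⟩ => ?_)
  have hidx₂ : Indexed I s₂.mem := fun j => (hmem _ (by omega) (by omega)).trans (hidx j)
  exact (ensures_output ((hs₂.reg_eq rfl).trans hload.jobs) hidx₂ hflag).mono
    (Nat.le_add_right _ _) fun s₃ _ hπ => ⟨_, hπ, I.isOptimal_schedule hT hmax⟩

/-! ### The running time -/

theorem succ_pow_le_eight_mul_pow {n m : ℕ} (hm : m ≤ 2 * n) : (n + 1) ^ m ≤ 8 * n ^ m := by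
  obtain rfl | hn := n.eq_zero_or_pos
  · obtain rfl : m = 0 := by omega
    norm_num
  have hn' : (0 : ℝ) < n := by exact_mod_cast hn
  have hexp : ((1 : ℝ) + 1 / n) ^ m ≤ 8 := by
    calc ((1 : ℝ) + 1 / n) ^ m ≤ Real.exp (1 / n) ^ m := by
          gcongr
          rw [add_comm]
          exact Real.add_one_le_exp _
      _ = Real.exp (m * (1 / n)) := (Real.exp_nat_mul _ _).symm
      _ ≤ Real.exp (2 : ℕ) := by
          rw [Real.exp_le_exp, mul_one_div, div_le_iff₀ hn']
          exact_mod_cast hm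
      _ = Real.exp 1 ^ 2 := by rw [Real.exp_one_pow]
      _ ≤ 8 := by nlinarith [Real.exp_one_lt_d9, Real.exp_pos 1]
  have hreal : ((n : ℝ) + 1) ^ m ≤ 8 * (n : ℝ) ^ m := by
    calc ((n : ℝ) + 1) ^ m = (1 + 1 / n) ^ m * (n : ℝ) ^ m := by
          rw [← mul_pow]
          congr 1
          field_simp
      _ ≤ 8 * (n : ℝ) ^ m := by gcongr
  exact_mod_cast hreal

theorem iterations_le (n : ℕ) (v : ℕ → ℕ) :
    (n + 1) * (n + 1) + ((n + 1) ^ #((range n).image v) + 1) * (n + 1) ≤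
      24 * (n ^ (#((range n).image v) + 1) * Nat.log 2 n + 1) := by
  have hm : #((range n).image v) ≤ n := card_image_le.trans_eq (card_range n)
  have hm' (hn : 0 < n) : 0 < #((range n).image v) :=
    card_pos.2 ((nonempty_range_iff.2 hn.ne').image v)
  generalize #((range n).image v) = m at *
  obtain rfl | rfl | hn : n = 0 ∨ n = 1 ∨ 2 ≤ n := by omega
  · obtain rfl : m = 0 := by omega
    norm_num
  · obtain rfl : m = 1 := by omega
    norm_num
  have hpow : (n + 1) ^ (m + 1) ≤ 8 * (n ^ (m + 1) * Nat.log 2 n) :=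
    (succ_pow_le_eight_mul_pow (by omega)).trans
      (Nat.mul_le_mul_left 8 (Nat.le_mul_of_pos_right _ (Nat.log_pos one_lt_two hn)))
  calc (n + 1) * (n + 1) + ((n + 1) ^ m + 1) * (n + 1)
      = (n + 1) ^ 2 + ((n + 1) ^ (m + 1) + (n + 1)) := by ring
    _ ≤ (n + 1) ^ (m + 1) + ((n + 1) ^ (m + 1) + (n + 1) ^ (m + 1)) := by
        gcongr
        · exact n.succ_pos
        · exact Nat.succ_le_succ (hm' (by omega))
        · exact Nat.le_self_pow m.succ_ne_zero _
    _ ≤ 24 * (n ^ (m + 1) * Nat.log 2 n + 1) := by omega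

theorem exists_runs_solve {n f : ℕ} {I : Instance n} {v : ℕ → ℕ}
    (hf : f = 1 ∧ v = I.eddJobs.p ∨ f = 3 ∧ v = I.eddJobs.w) :
    ∃ t s, Runs unitCost (solve f) I.initialState t s ∧
      t ≤ (solve f).size * 24 * (n ^ (#((range n).image v) + 1) * Nat.log 2 n + 1) ∧
      ∃ π, s.Holds π ∧ I.IsOptimal π := by
  rw [Nat.mul_assoc]
  exact (ensures_solve hf).mono (iterations_le n v) fun _ _ h => h

theorem solve_solves {f : ℕ} (hf : f = 1 ∨ f = 3) : (solve f).Solves := by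
  intro n I
  obtain ⟨v, hv⟩ : ∃ v, f = 1 ∧ v = I.eddJobs.p ∨ f = 3 ∧ v = I.eddJobs.w :=
    hf.elim (fun hf => ⟨_, .inl ⟨hf, rfl⟩⟩) fun hf => ⟨_, .inr ⟨hf, rfl⟩⟩
  obtain ⟨t, s, hr, -, π, hπ⟩ := exists_runs_solve hv
  exact ⟨t, s, π, hr, hπ⟩

theorem solve_runsInTime_numWeights : (solve 3).RunsInTime Instance.numWeights :=
  ⟨(solve 3).size * 24, fun _ I =>
    let ⟨t, s, hr, ht, _⟩ := exists_runs_solve (I := I) (.inr ⟨rfl, rfl⟩)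
    ⟨t, s, hr, ht.trans_eq (by rw [I.card_image_eddJobs_w])⟩⟩

theorem solve_runsInTime_numProcTimes : (solve 1).RunsInTime Instance.numProcTimes :=
  ⟨(solve 1).size * 24, fun _ I =>
    let ⟨t, s, hr, ht, _⟩ := exists_runs_solve (I := I) (.inl ⟨rfl, rfl⟩)
    ⟨t, s, hr, ht.trans_eq (by rw [I.card_image_eddJobs_p])⟩⟩

end TardyJobs

theorem theorem3 :
    (∃ P : TardyJobs.Prog, P.Solves ∧
      P.RunsInTime TardyJobs.Instance.numWeights ∧
      P.PolyTimeForConstant TardyJobs.Instance.numWeights) ∧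
    (∃ P : TardyJobs.Prog, P.Solves ∧
      P.RunsInTime TardyJobs.Instance.numProcTimes ∧
      P.PolyTimeForConstant TardyJobs.Instance.numProcTimes) := by
  refine ⟨⟨TardyJobs.solve 3, ?_, ?_, ?_⟩, TardyJobs.solve 1, ?_, ?_, ?_⟩
  · exact TardyJobs.solve_solves (.inr rfl)
  · exact TardyJobs.solve_runsInTime_numWeights
  · exact TardyJobs.solve_runsInTime_numWeights.polyTimeForConstant
  · exact TardyJobs.solve_solves (.inl rfl)
  · exact TardyJobs.solve_runsInTime_numProcTimes
  · exact TardyJobs.solve_runsInTime_numProcTimes.polyTimeForConstant
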